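/- Let $1<p<\infty$ and let $G$ be a locally compact (Hausdorff) group. Conventions (all spaces are complex): - A $QSL_p$-space is a Banach space that is isometrically isomorphic to a quotient of a closed subspace of some $L_p(X)$ by a closed subspace. $\mathrm{Rep}_p(G)$ denotes the class of pairs $(\pi,E)$, where $E$ is a $QSL_p$-space and $\pi$ is a homomorphism from $G$ to the group of invertible linear isometries of $E$ that is continuous for the strong operator topology. For $f\in L_1(G)$ (left Haar measure) put $\pi(f)\xi=\int_G f(x)\pi(x)\xi\,dx$, and let $PF_{p,\pi}(G)$ be the norm closure of $\{\pi(f): f\in L_1(G)\}$ in $\mathcal B(E)$. - $(\rho,F)\subseteq(\pi,E)$ means that $(\rho,F)$ is equivalent, by an invertible isometry intertwining the actions, to the restriction of $\pi$ to a closed $\pi$-invariant subspace of $E$. A representation $(\rho,F)\in\mathrm{Rep}_p(G)$ is cyclic if $\{\rho(f)\xi_0: f\in L_1(G)\}$ is dense in $F$ for some $\xi_0\in F$. A representation in $\mathrm{Rep}_p(G)$ is $p$-universal if it contains every cyclic representation in $\mathrm{Rep}_p(G)$. - For a $p$-universal $(\pi,E)$, $B_p(G)$ is the space of all functions $u:G\to\mathbb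 C$ of the form $u(x)=\sum_{n=1}^\infty\langle\pi(x)\xi_n,\eta_n\rangle$ with $\xi_n\in E$, $\eta_n\in E^*$ and $\sum_n\|\xi_n\|\|\eta_n\|<\infty$, with the norm $\|u\|=\inf\sum_n\|\xi_n\|\|\eta_n\|$ over all such expressions of $u$. Let $N$ be a closed normal subgroup of $G$ and $q:G\to G/N$ the quotient map. Then: 1. If $(\rho,F)\in\mathrm{Rep}_p(G/N)$, then $(\rho\circ q,F)\in\mathrm{Rep}_p(G)$, and $PF_{p,\rho}(G/N)=PF_{p,\rho\circ q}(G)$ as normed subspaces of $\mathcal B(F)$ (so the identification is isometric). 2. Let $(\pi,E)\in\mathrm{Rep}_p(G)$ and $K=\{\xi\in E:\pi(n)\xi=\xi\text{ for all }n\in N\}$. Then $\tilde\pi_K(xN)=\pi(x)|_K$ defines a representation $(\tilde\pi_K,K)\in\mathrm{Rep}_p(G/N)$ with $(\tilde\pi_K\circ q,K)\subseteq(\pi,E)$. If $(\pi,E)$ is $p$-universal for $G$, then $(\tilde\pi_K,K)$ is $p$-universal for $G/N$. 3. Let $B_p(G:N)$ be the space of the functions in $B_p(G)$ that are constant on each coset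 of $N$, with the norm of $B_p(G)$. Then $B_p(G:N)=B_p(G/N)$ isometrically: $u\mapsto u\circ q$ is a linear isometric bijection of $B_p(G/N)$ onto $B_p(G:N)$. 4. The map $\Phi_q:B_p(G/N)\to B_p(G)$, $\Phi_q(u)=u\circ q$, is a linear isometry. In 3 and 4, $B_p(G)$ and $B_p(G/N)$ may be formed from any $p$-universal representations of $G$ and of $G/N$. -/

import Mathlib

universe u v w

open scoped ENNReal

noncomputable section

namespace PFourier

/-! ### Subspaces of quotients of `L_p`-spaces -/

/-- A normed space `E` is a `QSL_p`-space if it is isometrically isomorphic to a quotient `S ⧸ T`,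
where `S` is a closed subspace of some `L_p(X, μ)` (complex scalars) and `T` is a closed subspace
of `S`; the quotient carries the quotient norm. -/
def IsQSL (p : ℝ≥0∞) [Fact (1 ≤ p)] (E : Type u) [NormedAddCommGroup E] [NormedSpace ℂ E] : Prop :=
  ∃ (X : Type u) (_ : MeasurableSpace X) (μ : MeasureTheory.Measure X)
    (S : Submodule ℂ (MeasureTheory.Lp ℂ p μ)) (T : Submodule ℂ S),
    IsClosed (S : Set (MeasureTheory.Lp ℂ p μ)) ∧ IsClosed (T : Set S) ∧
      Nonempty (E ≃ₗᵢ[ℂ] (S ⧸ T))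

/-! ### Isometric representations -/

/-- A representation of a topological group `G` on `E`: a group homomorphism from `G` to the
invertible linear isometries of `E`, continuous for the strong operator topology. -/
structure IsoRep (G : Type u) [Group G] [TopologicalSpace G]
    (E : Type v) [NormedAddCommGroup E] [NormedSpace ℂ E] where
  toHom : G →* (E ≃ₗᵢ[ℂ] E)
  continuous_apply : ∀ ξ : E, Continuous fun x : G => toHom x ξ

section Rep

variable {G : Type u} [Group G] [TopologicalSpace G]
variable {E : Type v} [NormedAddCommGroup E] [NormedSpace ℂ E]
variable {F : Type w} [NormedAddCommGroup F] [NormedSpace ℂ F]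

instance : CoeFun (IsoRep G E) (fun _ => G → (E ≃ₗᵢ[ℂ] E)) := ⟨fun π => π.toHom⟩

/-- `(π, E) ∈ Rep_p(G)`: the space of the representation is a `QSL_p`-space. -/
def InRep (p : ℝ≥0∞) [Fact (1 ≤ p)] (_π : IsoRep G E) : Prop := IsQSL p E

/-- Two representations are equivalent if an invertible isometry intertwines them. -/
def IsoRep.Equivalent (ρ : IsoRep G F) (π : IsoRep G E) : Prop :=
  ∃ T : F ≃ₗᵢ[ℂ] E, ∀ (x : G) (ξ : F), T (ρ x ξ) = π x (T ξ)

/-- The restriction of a representation to an invariant subspace. -/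
def IsoRep.restrict (π : IsoRep G E) (S : Submodule ℂ E)
    (hS : ∀ (x : G), ∀ ξ ∈ S, π x ξ ∈ S) : IsoRep G S where
  toHom :=
    { toFun := fun x =>
        { toFun := fun ξ => ⟨π x ξ, hS x ξ ξ.2⟩
          invFun := fun ξ => ⟨π x⁻¹ ξ, hS x⁻¹ ξ ξ.2⟩
          map_add' := fun ξ ζ => by ext; simp
          map_smul' := fun c ξ => by ext; simp
          left_inv := fun ξ => by
            ext; change (π.toHom x⁻¹ * π.toHom x) (ξ : E) = ξ; simp
          right_inv := fun ξ => by
            ext; change (π.toHom x * π.toHom x⁻¹) (ξ : E) = ξ; simp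
          norm_map' := fun ξ => (π x).norm_map (ξ : E) }
      map_one' := by ext ξ; change (π.toHom 1) (ξ : E) = ξ; simp
      map_mul' := fun x y => by
        ext ξ; change (π.toHom (x * y)) (ξ : E) = π.toHom x (π.toHom y ξ); simp [map_mul] }
  continuous_apply := fun ξ => (π.continuous_apply (ξ : E)).subtype_mk _

/-- `(ρ, F) ⊆ (π, E)`: `ρ` is equivalent to a subrepresentation of `π`, that is, to the restriction
of `π` to a closed invariant subspace. -/
def IsoRep.ContainedIn (ρ : IsoRep G F) (π : IsoRep G E) : Prop :=
  ∃ (S : Submodule ℂ E) (_ : IsClosed (S : Set E)) (hS : ∀ (x : G), ∀ ξ ∈ S, π x ξ ∈ S),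
    ρ.Equivalent (π.restrict S hS)

end Rep

/-! ### Integrated representations -/

section Integrated

open MeasureTheory

variable {G : Type u} [Group G] [TopologicalSpace G] [IsTopologicalGroup G] [LocallyCompactSpace G]
variable {E : Type v} [NormedAddCommGroup E] [NormedSpace ℂ E]

/-- An integrable function times a continuous vector-valued function is a.e. strongly measurable
for a regular measure (no separability or `σ`-compactness is needed). -/
theorem aestronglyMeasurable_smul [MeasurableSpace G] [BorelSpace G] (μ : Measure G) [μ.Regular]
    {f : G → ℂ} (hf : Integrable f μ) {g : G → E} (hg : Continuous g) :
    AEStronglyMeasurable (fun x => f x • g x) μ := by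
  have hA : ∀ A : Set G, MeasurableSet A → μ A ≠ ⊤ → AEStronglyMeasurable g (μ.restrict A) := by
    intro A hA hμA
    have H : ∀ n : ℕ, ∃ K ⊆ A, IsCompact K ∧ IsClosed K ∧ μ (A \ K) < ((n : ℝ≥0∞) + 1)⁻¹ :=
      fun n => hA.exists_isCompact_isClosed_sdiff_lt hμA (by simp)
    choose K hKA hK hKc hKμ using H
    have hz : μ (A \ ⋃ n, K n) = 0 := by
      refine le_antisymm (ge_of_tendsto' ENNReal.tendsto_inv_nat_nhds_zero fun n => ?_) zero_le
      refine (measure_mono (Set.sdiff_subset_sdiff_right (Set.subset_iUnion K n))).trans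
        ((hKμ n).le.trans (ENNReal.inv_le_inv.2 le_self_add))
    have he : (⋃ n, K n : Set G) =ᵐ[μ] A :=
      Filter.EventuallyLE.antisymm (Set.iUnion_subset hKA).eventuallyLE (ae_le_set.2 hz)
    rw [← Measure.restrict_congr_set he, aestronglyMeasurable_iUnion_iff]
    exact fun n => hg.continuousOn.aestronglyMeasurable_of_isCompact (hK n) (hKc n).measurableSet
  obtain ⟨f', ⟨s, hs, hlim⟩, hff'⟩ := hf.aefinStronglyMeasurable
  have hae : AEStronglyMeasurable (fun x => f' x • g x) μ := by
    refine aestronglyMeasurable_of_tendsto_ae Filter.atTop (f := fun n x => s n x • g x)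
      (fun n => ?_) (Filter.Eventually.of_forall fun x => (hlim x).smul_const _)
    have hm : MeasurableSet (Function.support (s n)) := (s n).measurableSet_support
    have e : (fun x => s n x • g x) = fun x => s n x • (Function.support (s n)).indicator g x := by
      funext x
      by_cases hx : s n x = 0
      · simp [hx]
      · rw [Set.indicator_of_mem (by simpa using hx)]
    rw [e]
    exact (s n).aestronglyMeasurable.smul
      ((aestronglyMeasurable_indicator_iff hm).2 (hA _ hm (hs n).ne))
  refine hae.congr ?_
  filter_upwards [hff'] with x hx
  rw [hx]

theorem integrable_smul_rep [MeasurableSpace G] [BorelSpace G] (μ : Measure G) [μ.Regular]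
    (π : IsoRep G E) {f : G → ℂ} (hf : Integrable f μ) (ξ : E) :
    Integrable (fun x => f x • π x ξ) μ := by
  refine (hf.norm.mul_const ‖ξ‖).mono' (aestronglyMeasurable_smul μ hf (π.continuous_apply ξ)) ?_
  filter_upwards with x
  rw [norm_smul, (π x).norm_map]

/-- `π(f) ξ = ∫ f(x) π(x) ξ dμ(x)`, as a linear map `f ↦ π(f)` from `L_1(G, μ)` to `B(E)`. -/
def integratedWith [MeasurableSpace G] [BorelSpace G] (μ : Measure G) [μ.Regular]
    (π : IsoRep G E) : Lp ℂ 1 μ →ₗ[ℂ] (E →L[ℂ] E) where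
  toFun f := LinearMap.mkContinuous
    { toFun := fun ξ => ∫ x, f x • π x ξ ∂μ
      map_add' := fun ξ ζ => by
        simp only [map_add, smul_add]
        exact integral_add (integrable_smul_rep μ π (L1.integrable_coeFn f) ξ)
          (integrable_smul_rep μ π (L1.integrable_coeFn f) ζ)
      map_smul' := fun c ξ => by
        simp only [map_smul, RingHom.id_apply]
        rw [← integral_smul]
        simp only [smul_comm c] } ‖f‖ (fun ξ => by
      refine (norm_integral_le_integral_norm _).trans ?_
      simp only [norm_smul, LinearIsometryEquiv.norm_map]
      rw [integral_mul_const, L1.norm_eq_integral_norm])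
  map_add' f g := by
    ext ξ
    simp only [LinearMap.mkContinuous_apply, LinearMap.coe_mk, AddHom.coe_mk,
      add_apply]
    rw [← integral_add (integrable_smul_rep μ π (L1.integrable_coeFn f) ξ)
      (integrable_smul_rep μ π (L1.integrable_coeFn g) ξ)]
    refine integral_congr_ae ?_
    filter_upwards [Lp.coeFn_add f g] with x hx
    rw [hx, Pi.add_apply, add_smul]
  map_smul' c f := by
    ext ξ
    simp only [LinearMap.mkContinuous_apply, LinearMap.coe_mk, AddHom.coe_mk,
      smul_apply, RingHom.id_apply]
    rw [← integral_smul]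
    refine integral_congr_ae ?_
    filter_upwards [Lp.coeFn_smul c f] with x hx
    rw [hx, Pi.smul_apply, smul_assoc]

variable (G) in
/-- Left Haar measure on the Borel sets of a locally compact group. -/
def leftHaar : @Measure G (borel G) :=
  letI : MeasurableSpace G := borel G
  haveI : BorelSpace G := ⟨rfl⟩
  Measure.haar

instance regular_leftHaar :
    @Measure.Regular G (borel G) _ (leftHaar G) :=
  letI : MeasurableSpace G := borel G
  haveI : BorelSpace G := ⟨rfl⟩
  inferInstanceAs (Measure.Regular (Measure.haar (G := G)))

variable (G) in
/-- The group algebra `L_1(G)`, as a Banach space. -/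
abbrev L1 : Type u := @Lp G ℂ (borel G) _ 1 (leftHaar G)

/-- The lift `f ↦ π(f)` of a representation of `G` to `L_1(G)`. -/
def IsoRep.integrated (π : IsoRep G E) : L1 G →ₗ[ℂ] (E →L[ℂ] E) :=
  letI : MeasurableSpace G := borel G
  haveI : BorelSpace G := ⟨rfl⟩
  integratedWith (leftHaar G) π

/-- The `p`-pseudofunctions `PF_{p,π}(G)` associated with `π`: the norm closure of
`{π(f) : f ∈ L_1(G)}` in `B(E)`. -/
def IsoRep.pseudofunctions (π : IsoRep G E) : Submodule ℂ (E →L[ℂ] E) :=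
  (LinearMap.range π.integrated).topologicalClosure

/-- `(π, E) ∈ Cyc_p(G)`: `E` is a `QSL_p`-space and `{π(f) ξ₀ : f ∈ L_1(G)}` is dense in `E` for
some `ξ₀ ∈ E`. -/
def InCyc (p : ℝ≥0∞) [Fact (1 ≤ p)] (π : IsoRep G E) : Prop :=
  InRep p π ∧ ∃ ξ₀ : E, Dense (Set.range fun f : L1 G => π.integrated f ξ₀)

end Integrated

/-- `(π, E) ∈ Rep_p(G)` is `p`-universal if it contains every member of `Cyc_p(G)`. -/
def IsUniversal (p : ℝ≥0∞) [Fact (1 ≤ p)] {G : Type u} [Group G] [TopologicalSpace G]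
    [IsTopologicalGroup G] [LocallyCompactSpace G]
    {E : Type u} [NormedAddCommGroup E] [NormedSpace ℂ E] (π : IsoRep G E) : Prop :=
  InRep p π ∧ ∀ (F : Type u) [NormedAddCommGroup F] [NormedSpace ℂ F] [CompleteSpace F]
    (ρ : IsoRep G F), InCyc p ρ → ρ.ContainedIn π

/-! ### Representations of a quotient group -/

section Quotient

variable {G : Type u} [Group G] [TopologicalSpace G] (N : Subgroup G)
variable {E : Type v} [NormedAddCommGroup E] [NormedSpace ℂ E]

/-- The representation `ρ ∘ q` of `G`, where `q : G → G ⧸ N` is the quotient map. -/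
def IsoRep.compQuotient [N.Normal] (ρ : IsoRep (G ⧸ N) E) : IsoRep G E where
  toHom := ρ.toHom.comp (QuotientGroup.mk' N)
  continuous_apply := fun ξ => (ρ.continuous_apply ξ).comp continuous_quotient_mk'

/-- The subspace `K` of the vectors fixed by `π(n)` for all `n ∈ N`. -/
def IsoRep.fixedVectors (π : IsoRep G E) : Submodule ℂ E where
  carrier := {ξ | ∀ n ∈ N, π n ξ = ξ}
  add_mem' := fun {ξ ζ} hξ hζ n hn => by rw [map_add, hξ n hn, hζ n hn]
  zero_mem' := fun n _ => map_zero _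
  smul_mem' := fun c ξ hξ n hn => by rw [map_smul, hξ n hn]

theorem IsoRep.isClosed_fixedVectors (π : IsoRep G E) :
    IsClosed (π.fixedVectors N : Set E) := by
  have : (π.fixedVectors N : Set E) = ⋂ n ∈ N, {ξ | π n ξ = ξ} := by
    ext ξ; simp [IsoRep.fixedVectors]
  rw [this]
  exact isClosed_biInter fun n _ => isClosed_eq (π n).continuous continuous_id

theorem IsoRep.apply_mem_fixedVectors [N.Normal] (π : IsoRep G E) (x : G) (ξ : E)
    (hξ : ξ ∈ π.fixedVectors N) : π x ξ ∈ π.fixedVectors N := by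
  intro n hn
  have h := hξ (x⁻¹ * n * x) (by simpa using ‹N.Normal›.conj_mem n hn x⁻¹)
  calc π n (π x ξ) = π x (π (x⁻¹ * n * x) ξ) := by
        change (π.toHom n * π.toHom x) ξ = (π.toHom x * π.toHom (x⁻¹ * n * x)) ξ
        rw [← map_mul, ← map_mul]; congr 2; group
    _ = π x ξ := by rw [h]

/-- The representation of `G ⧸ N` induced on the space `K` of `N`-fixed vectors of `π`, given by
`xN ↦ π(x)|_K`. -/
def IsoRep.fixedRep [N.Normal] (π : IsoRep G E) : IsoRep (G ⧸ N) (π.fixedVectors N) where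
  toHom := QuotientGroup.lift N
    (π.restrict (π.fixedVectors N) (π.apply_mem_fixedVectors N)).toHom
    (fun n hn => by ext ξ; exact ξ.2 n hn)
  continuous_apply := fun ξ => (QuotientGroup.isQuotientMap_mk N).continuous_iff.2
    ((π.restrict (π.fixedVectors N) (π.apply_mem_fixedVectors N)).continuous_apply ξ)

end Quotient

/-! ### The spaces of coefficient functions -/

section Coefficients

variable {G : Type u} [Group G] [TopologicalSpace G]
variable {E : Type v} [NormedAddCommGroup E] [NormedSpace ℂ E]

/-- `u(x) = ∑ₙ ⟨π(x) ξₙ, ηₙ⟩` for all `x ∈ G`, where `∑ₙ ‖ξₙ‖ ‖ηₙ‖ < ∞`. -/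
def IsoRep.IsExpansion (π : IsoRep G E) (u : G → ℂ) (ξ : ℕ → E) (η : ℕ → StrongDual ℂ E) : Prop :=
  (Summable fun n => ‖ξ n‖ * ‖η n‖) ∧ ∀ x : G, HasSum (fun n => η n (π x (ξ n))) (u x)

/-- All the values `∑ₙ ‖ξₙ‖ ‖ηₙ‖` over the expansions of `u`. -/
def IsoRep.costs (π : IsoRep G E) (u : G → ℂ) : Set ℝ :=
  {r | ∃ (ξ : ℕ → E) (η : ℕ → StrongDual ℂ E), π.IsExpansion u ξ η ∧ r = ∑' n, ‖ξ n‖ * ‖η n‖}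

theorem IsoRep.costs_nonneg (π : IsoRep G E) {u : G → ℂ} {r : ℝ} (hr : r ∈ π.costs u) : 0 ≤ r := by
  obtain ⟨ξ, η, -, rfl⟩ := hr
  exact tsum_nonneg fun n => by positivity

theorem IsoRep.norm_apply_le_cost (π : IsoRep G E) {u : G → ℂ} {r : ℝ} (hr : r ∈ π.costs u)
    (x : G) : ‖u x‖ ≤ r := by
  obtain ⟨ξ, η, ⟨h1, h2⟩, rfl⟩ := hr
  have hb : ∀ n, ‖η n (π x (ξ n))‖ ≤ ‖ξ n‖ * ‖η n‖ := fun n => by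
    simpa [mul_comm] using (η n).le_opNorm (π x (ξ n))
  rw [← (h2 x).tsum_eq]
  exact tsum_of_norm_bounded h1.hasSum hb

theorem IsoRep.zero_mem_costs (π : IsoRep G E) : (0 : ℝ) ∈ π.costs 0 :=
  ⟨fun _ => 0, fun _ => 0, ⟨by simp, fun x => by simp⟩,
    by simp⟩

theorem IsoRep.smul_mem_costs (π : IsoRep G E) (c : ℂ) {u : G → ℂ} {r : ℝ} (hr : r ∈ π.costs u) :
    ‖c‖ * r ∈ π.costs (c • u) := by
  obtain ⟨ξ, η, ⟨h1, h2⟩, rfl⟩ := hr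
  have e : (fun n => ‖c • ξ n‖ * ‖η n‖) = fun n => ‖c‖ * (‖ξ n‖ * ‖η n‖) := by
    funext n; rw [norm_smul, mul_assoc]
  refine ⟨fun n => c • ξ n, η, ⟨?_, fun x => ?_⟩, ?_⟩
  · rw [e]; exact h1.mul_left _
  · simpa using (h2 x).mul_left c
  · rw [e, tsum_mul_left]

theorem IsoRep.add_mem_costs (π : IsoRep G E) {u v : G → ℂ} {r s : ℝ} (hr : r ∈ π.costs u)
    (hs : s ∈ π.costs v) : r + s ∈ π.costs (u + v) := by
  obtain ⟨ξ, η, ⟨h1, h2⟩, rfl⟩ := hr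
  obtain ⟨ξ', η', ⟨h1', h2'⟩, rfl⟩ := hs
  let e : ℕ ≃ ℕ ⊕ ℕ := Equiv.natSumNatEquivNat.symm
  have hn : HasSum (fun n => ‖Sum.elim ξ ξ' (e n)‖ * ‖Sum.elim η η' (e n)‖)
      ((∑' n, ‖ξ n‖ * ‖η n‖) + ∑' n, ‖ξ' n‖ * ‖η' n‖) :=
    (e.hasSum_iff (f := fun i => ‖Sum.elim ξ ξ' i‖ * ‖Sum.elim η η' i‖)).2
      (HasSum.sum h1.hasSum h1'.hasSum)
  refine ⟨fun n => Sum.elim ξ ξ' (e n), fun n => Sum.elim η η' (e n), ⟨hn.summable, fun x => ?_⟩,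
    hn.tsum_eq.symm⟩
  exact (e.hasSum_iff (f := fun i => (Sum.elim η η' i) (π x (Sum.elim ξ ξ' i)))).2
    (HasSum.sum (h2 x) (h2' x))

/-- The functions `u : G → ℂ` of the form `u(x) = ∑ₙ ⟨π(x) ξₙ, ηₙ⟩` with
`∑ₙ ‖ξₙ‖ ‖ηₙ‖ < ∞`, as a linear subspace of all functions. -/
def IsoRep.coefficients (π : IsoRep G E) : Submodule ℂ (G → ℂ) where
  carrier := {u | ∃ (ξ : ℕ → E) (η : ℕ → StrongDual ℂ E), π.IsExpansion u ξ η}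
  add_mem' := by
    rintro u v ⟨ξ, η, h⟩ ⟨ξ', η', h'⟩
    obtain ⟨a, b, hab, -⟩ := π.add_mem_costs ⟨ξ, η, h, rfl⟩ ⟨ξ', η', h', rfl⟩
    exact ⟨a, b, hab⟩
  zero_mem' := by
    obtain ⟨a, b, hab, -⟩ := π.zero_mem_costs
    exact ⟨a, b, hab⟩
  smul_mem' := by
    rintro c u ⟨ξ, η, h⟩
    obtain ⟨a, b, hab, -⟩ := π.smul_mem_costs c ⟨ξ, η, h, rfl⟩
    exact ⟨a, b, hab⟩

/-- The space `A_{p,π}` of a representation, which carries the norm defined below. For a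
`p`-universal representation `π` of `G` it is the `p`-analog `B_p(G)` of the Fourier-Stieltjes
algebra. -/
def FourierSpace (π : IsoRep G E) : Type u := π.coefficients

namespace FourierSpace

variable (π : IsoRep G E)

instance : AddCommGroup (FourierSpace π) := inferInstanceAs (AddCommGroup π.coefficients)

instance : Module ℂ (FourierSpace π) := inferInstanceAs (Module ℂ π.coefficients)

instance : CoeFun (FourierSpace π) (fun _ => G → ℂ) := ⟨fun u => u.1⟩

/-- `‖u‖ = inf ∑ₙ ‖ξₙ‖ ‖ηₙ‖`, over all the expansions of `u`. -/
instance : Norm (FourierSpace π) := ⟨fun u => sInf (π.costs u)⟩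

variable {π}

theorem norm_def (u : FourierSpace π) : ‖u‖ = sInf (π.costs u) := rfl

theorem costs_nonempty (u : FourierSpace π) : (π.costs u).Nonempty := by
  obtain ⟨ξ, η, h⟩ := u.2
  exact ⟨_, ξ, η, h, rfl⟩

theorem norm_le_cost (u : FourierSpace π) {r : ℝ} (hr : r ∈ π.costs u) : ‖u‖ ≤ r :=
  csInf_le ⟨0, fun _ h => π.costs_nonneg h⟩ hr

theorem norm_apply_le (u : FourierSpace π) (x : G) : ‖u x‖ ≤ ‖u‖ :=
  le_csInf (costs_nonempty u) fun _ hr => π.norm_apply_le_cost hr x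

theorem norm_smul_le' (c : ℂ) (u : FourierSpace π) : ‖c • u‖ ≤ ‖c‖ * ‖u‖ := by
  rw [norm_def u, ← smul_eq_mul, ← Real.sInf_smul_of_nonneg (norm_nonneg c)]
  refine le_csInf ((costs_nonempty u).smul_set) ?_
  rintro _ ⟨r, hr, rfl⟩
  exact norm_le_cost (c • u) (π.smul_mem_costs c hr)

theorem core (π : IsoRep G E) : NormedSpace.Core ℂ (FourierSpace π) where
  norm_nonneg u := Real.sInf_nonneg fun _ h => π.costs_nonneg h
  norm_smul c u := by
    refine le_antisymm (norm_smul_le' c u) ?_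
    rcases eq_or_ne c 0 with rfl | hc
    · rw [norm_zero, zero_mul]
      exact Real.sInf_nonneg fun _ h => π.costs_nonneg h
    · have h := norm_smul_le' c⁻¹ (c • u)
      rw [smul_smul, inv_mul_cancel₀ hc, one_smul, norm_inv] at h
      have hc' : 0 < ‖c‖ := norm_pos_iff.2 hc
      calc ‖c‖ * ‖u‖ ≤ ‖c‖ * (‖c‖⁻¹ * ‖c • u‖) := by gcongr
        _ = ‖c • u‖ := by rw [← mul_assoc, mul_inv_cancel₀ hc'.ne', one_mul]
  norm_triangle u v := by
    refine le_of_forall_pos_lt_add fun ε hε => ?_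
    obtain ⟨r, hr, hr'⟩ := exists_lt_of_csInf_lt (costs_nonempty u)
      (show sInf (π.costs u) < ‖u‖ + ε / 2 by rw [← norm_def]; linarith)
    obtain ⟨s, hs, hs'⟩ := exists_lt_of_csInf_lt (costs_nonempty v)
      (show sInf (π.costs v) < ‖v‖ + ε / 2 by rw [← norm_def]; linarith)
    have := norm_le_cost (u + v) (π.add_mem_costs hr hs)
    linarith
  norm_eq_zero_iff u := by
    constructor
    · intro h
      refine Subtype.ext (funext fun x => ?_)
      have := norm_apply_le u x
      rw [h] at this
      exact norm_le_zero_iff.1 this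
    · rintro rfl
      exact le_antisymm (norm_le_cost 0 π.zero_mem_costs)
        (Real.sInf_nonneg fun _ h => π.costs_nonneg h)

instance : NormedAddCommGroup (FourierSpace π) := NormedAddCommGroup.ofCore (core π)

instance : NormedSpace ℂ (FourierSpace π) := NormedSpace.ofCore (core π)

variable (π) in
/-- The functions in the space that are constant on each coset of `N`. For a `p`-universal
representation `π` of `G` this is `B_p(G : N)`. -/
def constOnCosets (N : Subgroup G) : Submodule ℂ (FourierSpace π) where
  carrier := {u | ∀ x y : G, (x : G ⧸ N) = (y : G ⧸ N) → u x = u y}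
  add_mem' := fun hu hv x y h => congrArg₂ (· + ·) (hu x y h) (hv x y h)
  zero_mem' := fun _ _ _ => rfl
  smul_mem' := fun c _ hu x y h => congrArg (c * ·) (hu x y h)

end FourierSpace

end Coefficients

end PFourier

end

noncomputable section

namespace PFourier

/-! Equality of pseudofunctions needs no integration along `N`. Let `π` and `ρ` be a representation
of `G ⧸ N` and its lift to `G`, in either order, and let `T = π(f)` with `f` continuous of compact
support. Then `x ↦ π(x)T` is norm continuous; since `q` is a quotient map, so is `y ↦ ρ(y)T`, and
`T` is a norm limit of operators `ρ(g)T`. Now `ρ(g)T = ∫ f(x) ρ(g)π(x) dx` is a norm integral of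
operators `ρ(g)ρ(y)`, each a multiple of `ρ` of a translate of `g`. This is
`topologicalClosure_range_integratedWith_mono`.

Consequently a cyclic representation of `G ⧸ N` lifts to a cyclic representation of `G`. A universal
`π` contains the lift, and `N` acts trivially on the copy, which therefore lies in the space of
fixed vectors. So `π.fixedRep N` is universal.

For the coefficient spaces, an expansion over `G ⧸ N` lifts to `G` at the same cost. The converse is
the difficulty: the terms of an expansion of `u ∘ q` need not be constant on cosets. Since
`QSL_p`-spaces are stable under `ℓ_p`-sums, Hölder's inequality collapses the expansion to one
coefficient `η(π(x)ξ)` at no higher cost (`IsoRep.exists_lpRep_coefficient`). Modulo the largest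
invariant subspace of `ker η` the vector `ξ` becomes `N`-fixed, so `u` is a coefficient of a
representation of `G ⧸ N` on a subspace of a quotient, again a `QSL_p`-space
(`IsoRep.exists_quotient_coefficient`). It passes to the universal representation through a cyclic
subspace and Hahn–Banach. -/

/-! ### Permanence properties of `QSL_p`-spaces -/

/-- A linear map is a metric surjection if the norm of `E` is the quotient norm. -/
def IsMetricSurjection {Y : Type v} {E : Type w} [NormedAddCommGroup Y] [NormedSpace ℂ Y]
    [NormedAddCommGroup E] [NormedSpace ℂ E] (Q : Y →ₗ[ℂ] E) : Prop :=
  (∀ y, ‖Q y‖ ≤ ‖y‖) ∧ ∀ e, ∀ δ : ℝ, 0 < δ → ∃ y, Q y = e ∧ ‖y‖ ≤ (1 + δ) * ‖e‖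

namespace IsMetricSurjection

variable {Y : Type v} {E : Type w} {F : Type*} [NormedAddCommGroup Y] [NormedSpace ℂ Y]
  [NormedAddCommGroup E] [NormedSpace ℂ E] [NormedAddCommGroup F] [NormedSpace ℂ F]
  {Q : Y →ₗ[ℂ] E}

theorem surjective (hQ : IsMetricSurjection Q) : Function.Surjective Q := fun e =>
  let ⟨y, hy, _⟩ := hQ.2 e 1 one_pos
  ⟨y, hy⟩

theorem comp {R : E →ₗ[ℂ] F} (hR : IsMetricSurjection R) (hQ : IsMetricSurjection Q) :
    IsMetricSurjection (R ∘ₗ Q) := by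
  refine ⟨fun y => (hR.1 _).trans (hQ.1 y), fun e δ hδ => ?_⟩
  -- The slack `1 + δ` is split into two equal factors, one for each lift.
  have h1 : 1 < Real.sqrt (1 + δ) := by
    rw [Real.lt_sqrt zero_le_one]; linarith
  obtain ⟨f, rfl, hf⟩ := hR.2 e (Real.sqrt (1 + δ) - 1) (by linarith)
  obtain ⟨y, rfl, hy⟩ := hQ.2 f (Real.sqrt (1 + δ) - 1) (by linarith)
  refine ⟨y, rfl, hy.trans ?_⟩
  rw [add_sub_cancel] at hf ⊢
  calc Real.sqrt (1 + δ) * ‖Q y‖ ≤ Real.sqrt (1 + δ) * (Real.sqrt (1 + δ) * ‖R (Q y)‖) := by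
        gcongr
    _ = (1 + δ) * ‖R (Q y)‖ := by
        rw [← mul_assoc, Real.mul_self_sqrt (by linarith)]

theorem of_linearIsometryEquiv (e : E ≃ₗᵢ[ℂ] F) :
    IsMetricSurjection (e.toLinearEquiv : E →ₗ[ℂ] F) :=
  ⟨fun y => (e.norm_map y).le, fun f δ hδ => ⟨e.symm f, e.apply_symm_apply f, by
    rw [e.symm.norm_map]; nlinarith [norm_nonneg f]⟩⟩

theorem mkQ (M : Submodule ℂ E) [hM : IsClosed (M : Set E)] : IsMetricSurjection M.mkQ := by
  refine ⟨fun y => Submodule.Quotient.norm_mk_le M y, fun e δ hδ => ?_⟩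
  rcases eq_or_ne e 0 with rfl | he
  · exact ⟨0, map_zero _, by simp⟩
  -- The additive slack `δ‖e‖` is positive only for `e ≠ 0`, hence the separate zero case.
  · obtain ⟨m, hm, hm'⟩ := Submodule.Quotient.norm_mk_lt e (mul_pos hδ (norm_pos_iff.2 he))
    exact ⟨m, hm, by linarith⟩

theorem isClosed_ker (hQ : IsMetricSurjection Q) : IsClosed (LinearMap.ker Q : Set Y) :=
  (Q.mkContinuous 1 fun y => by simpa using hQ.1 y).isClosed_ker

/-- The space of a metric surjection is the quotient by its kernel. -/
def quotientKerEquiv (hQ : IsMetricSurjection Q) [IsClosed (LinearMap.ker Q : Set Y)] :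
    (Y ⧸ LinearMap.ker Q) ≃ₗᵢ[ℂ] E where
  toLinearEquiv := Q.quotKerEquivOfSurjective hQ.surjective
  norm_map' := by
    intro z
    obtain ⟨y, rfl⟩ := Submodule.Quotient.mk_surjective _ z
    change ‖Q y‖ = _
    refine le_antisymm ?_ ?_
    · refine le_of_forall_pos_le_add fun ε hε => ?_
      obtain ⟨m, hm, hm'⟩ := Submodule.Quotient.norm_mk_lt
        (Submodule.Quotient.mk y : Y ⧸ LinearMap.ker Q) hε
      have : Q m = Q y := by
        rw [← sub_eq_zero, ← map_sub]
        exact (Submodule.Quotient.eq _).1 hm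
      rw [← this]
      exact (hQ.1 m).trans hm'.le
    · have key : ∀ δ : ℝ, 0 < δ →
          ‖(Submodule.Quotient.mk y : Y ⧸ LinearMap.ker Q)‖ ≤ (1 + δ) * ‖Q y‖ := by
        intro δ hδ
        obtain ⟨m, hm, hm'⟩ := hQ.2 (Q y) δ hδ
        have : (Submodule.Quotient.mk y : Y ⧸ LinearMap.ker Q) = Submodule.Quotient.mk m := by
          refine (Submodule.Quotient.eq _).2 ?_
          rw [LinearMap.mem_ker, map_sub, hm, sub_self]
        rw [this]
        exact (Submodule.Quotient.norm_mk_le _ m).trans hm'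
      refine le_of_forall_pos_le_add fun ε hε => ?_
      have h := key (ε / (‖Q y‖ + 1)) (by positivity)
      have h2 : ε / (‖Q y‖ + 1) * ‖Q y‖ ≤ ε := by
        rw [div_mul_eq_mul_div, div_le_iff₀ (by positivity)]
        nlinarith [norm_nonneg (Q y)]
      linarith

end IsMetricSurjection

/-! ### Stability of `QSL_p`-spaces under quotients and closed subspaces. -/

section QSL

open MeasureTheory

variable {p : ℝ≥0∞} [Fact (1 ≤ p)] {E F : Type u} [NormedAddCommGroup E] [NormedSpace ℂ E]
  [NormedAddCommGroup F] [NormedSpace ℂ F]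

/-- Completeness of `Y` makes the range of `j` closed, and `E` is the quotient of this range by a
kernel. Together with `IsQSL.exists_metricSurjection` this replaces literal quotients by metric
surjections, which compose. -/
theorem IsMetricSurjection.isQSL {X : Type u} [MeasurableSpace X] {μ : Measure X}
    {Y : Type v} [NormedAddCommGroup Y] [NormedSpace ℂ Y] [CompleteSpace Y]
    (j : Y →ₗᵢ[ℂ] Lp ℂ p μ) {Q : Y →ₗ[ℂ] E} (hQ : IsMetricSurjection Q) : IsQSL p E := by
  have hR := hQ.comp (IsMetricSurjection.of_linearIsometryEquiv j.equivRange.symm)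
  have := hR.isClosed_ker
  refine ⟨X, _, μ, LinearMap.range j.toLinearMap, _, ?_, this, ⟨hR.quotientKerEquiv.symm⟩⟩
  rw [LinearMap.coe_range]
  exact j.isometry.isClosedEmbedding.isClosed_range

theorem IsMetricSurjection.comp_mkQ {Y : Type v} [NormedAddCommGroup Y] [NormedSpace ℂ Y]
    {T : Submodule ℂ Y} (hT : IsClosed (T : Set Y)) (e : E ≃ₗᵢ[ℂ] (Y ⧸ T)) :
    IsMetricSurjection ((e.symm.toLinearEquiv : (Y ⧸ T) →ₗ[ℂ] E) ∘ₗ T.mkQ) :=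
  (IsMetricSurjection.of_linearIsometryEquiv e.symm).comp (IsMetricSurjection.mkQ T)

theorem IsQSL.exists_metricSurjection (h : IsQSL p E) :
    ∃ (X : Type u) (_ : MeasurableSpace X) (μ : Measure X) (Y : Type u) (_ : NormedAddCommGroup Y)
      (_ : NormedSpace ℂ Y) (_ : CompleteSpace Y) (_ : Y →ₗᵢ[ℂ] Lp ℂ p μ) (Q : Y →ₗ[ℂ] E),
      IsMetricSurjection Q := by
  obtain ⟨X, mX, μ, S, T, hS, hT, ⟨e⟩⟩ := h
  exact ⟨X, mX, μ, S, inferInstance, inferInstance, hS.completeSpace_coe, S.subtypeₗᵢ, _,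
    IsMetricSurjection.comp_mkQ hT e⟩

theorem IsQSL.of_isMetricSurjection (h : IsQSL p E) {R : E →ₗ[ℂ] F} (hR : IsMetricSurjection R) :
    IsQSL p F := by
  obtain ⟨X, mX, μ, Y, _, _, _, j, Q, hQ⟩ := h.exists_metricSurjection
  exact (hR.comp hQ).isQSL j

theorem IsQSL.quotient (h : IsQSL p E) (M : Submodule ℂ E) [IsClosed (M : Set E)] :
    IsQSL p (E ⧸ M) :=
  h.of_isMetricSurjection (IsMetricSurjection.mkQ M)

/-- A subspace of a quotient is a quotient of a subspace, namely of the preimage of `K` in `Y`. -/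
theorem IsQSL.submodule (h : IsQSL p E) (K : Submodule ℂ E) (hK : IsClosed (K : Set E)) :
    IsQSL p K := by
  obtain ⟨X, mX, μ, Y, _, _, _, j, Q, hQ⟩ := h.exists_metricSurjection
  have hQc : Continuous Q := (Q.mkContinuous 1 fun y => by simpa using hQ.1 y).continuous
  have hc : IsClosed (K.comap Q : Set Y) := hK.preimage hQc
  have : CompleteSpace (K.comap Q) := hc.completeSpace_coe
  have hR : IsMetricSurjection (Q.restrict (p := K.comap Q) (q := K) fun _ hx => hx) := by
    refine ⟨fun y => hQ.1 y, fun e δ hδ => ?_⟩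
    obtain ⟨y, hy, hy'⟩ := hQ.2 e δ hδ
    exact ⟨⟨y, by simp [hy]⟩, Subtype.ext hy, hy'⟩
  exact hR.isQSL (j.comp (K.comap Q).subtypeₗᵢ)

/-! ### The `ℓ_p`-sum of countably many copies of a `QSL_p`-space -/

section Lp

variable {X : Type u} [MeasurableSpace X]

/-- The measure on `ℕ × X` that restricts to `μ` on every copy of `X`. -/
def copiesMeasure (μ : Measure X) : Measure (ℕ × X) :=
  Measure.sum fun n => μ.map (Prod.mk n)

theorem measurableEmbedding_prodMk_nat (n : ℕ) :
    MeasurableEmbedding (Prod.mk n : X → ℕ × X) :=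
  .of_measurable_inverse measurable_prodMk_left
    (by
      have : Set.range (Prod.mk n : X → ℕ × X) = Prod.fst ⁻¹' {n} := by
        ext ⟨m, x⟩; simp [eq_comm]
      rw [this]; exact measurable_fst (measurableSet_singleton n))
    measurable_snd fun _ => rfl

theorem ae_copiesMeasure_iff {μ : Measure X} {P : ℕ × X → Prop} :
    (∀ᵐ z ∂copiesMeasure μ, P z) ↔ ∀ n, ∀ᵐ x ∂μ, P (n, x) := by
  rw [copiesMeasure, Measure.ae_sum_iff]
  exact forall_congr' fun n => (measurableEmbedding_prodMk_nat n).ae_map_iff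

theorem lintegral_copiesMeasure {μ : Measure X} (f : ℕ × X → ℝ≥0∞) :
    ∫⁻ z, f z ∂copiesMeasure μ = ∑' n, ∫⁻ x, f (n, x) ∂μ := by
  rw [copiesMeasure, lintegral_sum_measure]
  exact tsum_congr fun n => (measurableEmbedding_prodMk_nat n).lintegral_map f

variable {μ : Measure X}

/-- Joint measurability is automatic because the first coordinate is countable and each `f n` has a
measurable representative. -/
theorem stronglyMeasurable_uncurry_nat (f : ℕ → Lp ℂ p μ) :
    StronglyMeasurable fun z : ℕ × X => f z.1 z.2 :=
  (measurable_from_prod_countable_right fun n =>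
    (Lp.stronglyMeasurable (f n)).measurable).stronglyMeasurable

theorem eLpNorm_uncurry (hp' : p < ⊤) (f : lp (fun _ : ℕ => Lp ℂ p μ) p) :
    eLpNorm (fun z : ℕ × X => f z.1 z.2) p (copiesMeasure μ) = ENNReal.ofReal ‖f‖ := by
  have h1 : (1 : ℝ≥0∞) ≤ p := Fact.out
  have h0 : p ≠ 0 := (zero_lt_one.trans_le h1).ne'
  have hr : 0 < p.toReal := ENNReal.toReal_pos h0 hp'.ne
  have hn : ∀ n, ∫⁻ x, ‖f n x‖ₑ ^ p.toReal ∂μ = ENNReal.ofReal (‖f n‖ ^ p.toReal) := by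
    intro n
    rw [← ENNReal.ofReal_rpow_of_nonneg (norm_nonneg _) hr.le, Lp.norm_def,
      ENNReal.ofReal_toReal (Lp.eLpNorm_ne_top _), eLpNorm_eq_lintegral_rpow_enorm_toReal h0 hp'.ne,
      ← ENNReal.rpow_mul, one_div, inv_mul_cancel₀ hr.ne', ENNReal.rpow_one]
  rw [eLpNorm_eq_lintegral_rpow_enorm_toReal h0 hp'.ne, lintegral_copiesMeasure]
  simp only [hn]
  rw [← ENNReal.ofReal_tsum_of_nonneg (fun n => by positivity) ((lp.memℓp f).summable hr),
    ← lp.norm_rpow_eq_tsum hr, ENNReal.ofReal_rpow_of_nonneg (by positivity) (by positivity),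
    ← Real.rpow_mul (norm_nonneg _), mul_one_div, div_self hr.ne', Real.rpow_one]

theorem memLp_uncurry (hp' : p < ⊤) (f : lp (fun _ : ℕ => Lp ℂ p μ) p) :
    MemLp (fun z : ℕ × X => f z.1 z.2) p (copiesMeasure μ) :=
  ⟨(stronglyMeasurable_uncurry_nat _).aestronglyMeasurable, by
    rw [eLpNorm_uncurry hp']; exact ENNReal.ofReal_lt_top⟩

/-- The isometric embedding of the `ℓ_p`-sum of copies of `L_p(X, μ)` into `L_p(ℕ × X)`. -/
def lpToLp (hp' : p < ⊤) :
    lp (fun _ : ℕ => Lp ℂ p μ) p →ₗᵢ[ℂ] Lp ℂ p (copiesMeasure μ) where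
  toFun f := (memLp_uncurry hp' f).toLp
  map_add' f g := by
    refine Eq.trans ?_ (MemLp.toLp_add (memLp_uncurry hp' f) (memLp_uncurry hp' g))
    refine (MemLp.toLp_eq_toLp_iff _ _).2 (ae_copiesMeasure_iff.2 fun n => ?_)
    filter_upwards [Lp.coeFn_add (f n) (g n)] with x hx using hx
  map_smul' c f := by
    refine Eq.trans ?_ (MemLp.toLp_const_smul c (memLp_uncurry hp' f))
    refine (MemLp.toLp_eq_toLp_iff _ _).2 (ae_copiesMeasure_iff.2 fun n => ?_)
    filter_upwards [Lp.coeFn_smul c (f n)] with x hx using hx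
  norm_map' f := by
    refine (Lp.norm_toLp _ (memLp_uncurry hp' f)).trans ?_
    rw [eLpNorm_uncurry hp', ENNReal.toReal_ofReal (norm_nonneg _)]

end Lp

section lpMap

variable {Y : Type v} {Z : Type w} [NormedAddCommGroup Y] [NormedSpace ℂ Y]
  [NormedAddCommGroup Z] [NormedSpace ℂ Z]

/-- A contraction acts coordinatewise on `ℓ_p`-sums. -/
def lpMap (p : ℝ≥0∞) [Fact (1 ≤ p)] (Q : Y →ₗ[ℂ] Z) (hQ : ∀ y, ‖Q y‖ ≤ ‖y‖) :
    lp (fun _ : ℕ => Y) p →ₗ[ℂ] lp (fun _ : ℕ => Z) p where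
  toFun f := ⟨fun n => Q (f n), (lp.memℓp f).mono' fun n => hQ (f n)⟩
  map_add' f g := by ext n; exact map_add Q (f n) (g n)
  map_smul' c f := by ext n; exact map_smul Q c (f n)

@[simp]
theorem lpMap_apply (Q : Y →ₗ[ℂ] Z) (hQ : ∀ y, ‖Q y‖ ≤ ‖y‖) (f : lp (fun _ : ℕ => Y) p) (n : ℕ) :
    lpMap p Q hQ f n = Q (f n) := rfl

theorem norm_lpMap_le (Q : Y →ₗ[ℂ] Z) (hQ : ∀ y, ‖Q y‖ ≤ ‖y‖)
    (f : lp (fun _ : ℕ => Y) p) : ‖lpMap p Q hQ f‖ ≤ ‖f‖ :=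
  lp.norm_mono (zero_lt_one.trans_le (Fact.out : 1 ≤ p)).ne' fun n => hQ (f n)

theorem IsMetricSurjection.lpMap {Q : Y →ₗ[ℂ] Z} (hQ : IsMetricSurjection Q) :
    IsMetricSurjection (lpMap p Q hQ.1) := by
  refine ⟨norm_lpMap_le Q hQ.1, fun e δ hδ => ?_⟩
  choose y hy hy' using fun n => hQ.2 (e n) δ hδ
  -- The same factor `1 + δ` serves every coordinate, so the sequence of lifts is dominated by `(1 +
  -- δ)e` and lies in `ℓ_p`. Here the multiplicative form of the lifting condition pays off.
  let e' : lp (fun _ : ℕ => Z) p := ((1 + δ : ℝ) : ℂ) • e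
  have hb : ∀ n, ‖y n‖ ≤ ‖e' n‖ := fun n => by
    refine (hy' n).trans_eq ?_
    change _ = ‖((1 + δ : ℝ) : ℂ) • e n‖
    rw [norm_smul, Complex.norm_real, Real.norm_of_nonneg (by linarith)]
  let y' : lp (fun _ : ℕ => Y) p := ⟨y, (lp.memℓp e').mono' hb⟩
  refine ⟨y', by ext n; exact hy n, ?_⟩
  have h0 : p ≠ 0 := (zero_lt_one.trans_le (Fact.out : 1 ≤ p)).ne'
  refine (lp.norm_mono (x := y') (y := e') h0 hb).trans_eq ?_
  rw [norm_smul, Complex.norm_real, Real.norm_of_nonneg (by linarith)]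

/-- An isometry acts coordinatewise on `ℓ_p`-sums. -/
def lpMapIsometry (j : Y →ₗᵢ[ℂ] Z) :
    lp (fun _ : ℕ => Y) p →ₗᵢ[ℂ] lp (fun _ : ℕ => Z) p where
  toLinearMap := lpMap p j.toLinearMap fun y => (j.norm_map y).le
  norm_map' f := by
    have h0 : p ≠ 0 := (zero_lt_one.trans_le (Fact.out : 1 ≤ p)).ne'
    exact le_antisymm (lp.norm_mono h0 fun n => (j.norm_map (f n)).le)
      (lp.norm_mono h0 fun n => (j.norm_map (f n)).ge)

end lpMap

/-- The `ℓ_p`-sum of the surjections `Q` is again metric, and its domain embeds in `L_p(ℕ × X)`. -/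
theorem IsQSL.lp (hp' : p < ⊤) (h : IsQSL p E) : IsQSL p (lp (fun _ : ℕ => E) p) := by
  obtain ⟨X, mX, μ, Y, _, _, _, j, Q, hQ⟩ := h.exists_metricSurjection
  exact hQ.lpMap.isQSL ((lpToLp hp').comp (lpMapIsometry j))

end QSL

/-! ### Constructions of representations -/

section Constructions

variable {G : Type u} [Group G] [TopologicalSpace G]
variable {E : Type v} [NormedAddCommGroup E] [NormedSpace ℂ E]

theorem IsoRep.map_mul_apply (π : IsoRep G E) (x y : G) (ξ : E) : π (x * y) ξ = π x (π y ξ) := by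
  change π.toHom (x * y) ξ = (π.toHom x * π.toHom y) ξ; rw [map_mul]

theorem IsoRep.map_one_apply (π : IsoRep G E) (ξ : E) : π 1 ξ = ξ := by
  rw [map_one]; rfl

/-- A family of contractions that satisfies the laws of a representation is a representation. -/
def IsoRep.ofContractions (T : G → E →ₗ[ℂ] E) (hT : ∀ x ξ, ‖T x ξ‖ ≤ ‖ξ‖) (h1 : ∀ ξ, T 1 ξ = ξ)
    (hmul : ∀ x y ξ, T (x * y) ξ = T x (T y ξ)) (hc : ∀ ξ, Continuous fun x => T x ξ) :
    IsoRep G E where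
  toHom :=
    { toFun := fun x =>
        { toLinearEquiv := LinearEquiv.ofLinearMap (T x) (T x⁻¹)
            (by ext ξ; simp [← hmul, h1]) (by ext ξ; simp [← hmul, h1])
          norm_map' := fun ξ => by
            -- The reverse inequality is the contractivity of `T x⁻¹`.
            refine le_antisymm (hT x ξ) ?_
            change ‖ξ‖ ≤ ‖T x ξ‖
            calc ‖ξ‖ = ‖T x⁻¹ (T x ξ)‖ := by rw [← hmul, inv_mul_cancel, h1]
              _ ≤ _ := hT _ _ }
      map_one' := by ext ξ; exact h1 ξ
      map_mul' := fun x y => by ext ξ; exact hmul x y ξ }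
  continuous_apply := hc

/-- The representation on the quotient by an invariant subspace. -/
def IsoRep.quotientRep (π : IsoRep G E) (M : Submodule ℂ E) [IsClosed (M : Set E)]
    (hM : ∀ (x : G), ∀ ξ ∈ M, π x ξ ∈ M) : IsoRep G (E ⧸ M) :=
  IsoRep.ofContractions
    (fun x => M.mapQ M ((π x).toLinearEquiv : E →ₗ[ℂ] E) fun ξ hξ => hM x ξ hξ)
    (fun x z => by
      refine le_of_forall_pos_le_add fun ε hε => ?_
      obtain ⟨m, rfl, hm⟩ := Submodule.Quotient.norm_mk_lt z hε
      refine (Submodule.Quotient.norm_mk_le M (π x m)).trans ?_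
      rw [(π x).norm_map]
      exact hm.le)
    (fun z => by
      obtain ⟨m, rfl⟩ := Submodule.Quotient.mk_surjective _ z
      exact congrArg Submodule.Quotient.mk (π.map_one_apply m))
    (fun x y z => by
      obtain ⟨m, rfl⟩ := Submodule.Quotient.mk_surjective _ z
      exact congrArg Submodule.Quotient.mk (π.map_mul_apply x y m))
    (fun z => by
      obtain ⟨m, rfl⟩ := Submodule.Quotient.mk_surjective _ z
      exact M.mkQL.continuous.comp (π.continuous_apply m))

variable (p : ℝ≥0∞) [Fact (1 ≤ p)]

/-- For `p < ⊤` finite truncations converge to `f`, and since all the operators are contractions,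
the orbit maps of the truncations converge uniformly in `x`. -/
theorem IsoRep.continuous_lpMap (hp' : p < ⊤) (π : IsoRep G E) (f : lp (fun _ : ℕ => E) p) :
    Continuous fun x => lpMap p ((π x).toLinearEquiv : E →ₗ[ℂ] E)
      (fun ξ => ((π x).norm_map ξ).le) f := by
  classical
  have hs := (lp.hasSum_single hp'.ne f).tendsto_sum_nat
  refine continuous_of_uniform_approx_of_continuous fun U hU => ?_
  obtain ⟨ε, hε, hεU⟩ := Metric.mem_uniformity_dist.1 hU
  obtain ⟨n, hn⟩ := (Metric.tendsto_atTop.1 hs ε hε)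
  refine ⟨_, ?_, fun x => hεU (b := lpMap p ((π x).toLinearEquiv : E →ₗ[ℂ] E)
      (fun ξ => ((π x).norm_map ξ).le) (∑ i ∈ Finset.range n, lp.single p i (f i))) ?_⟩
  · simp only [map_sum]
    refine continuous_finsetSum _ fun i _ => ?_
    have : ∀ x, lpMap p ((π x).toLinearEquiv : E →ₗ[ℂ] E)
        (fun ξ => ((π x).norm_map ξ).le) (lp.single p i (f i)) = lp.single p i (π x (f i)) := by
      intro x
      ext j
      by_cases h : j = i
      · subst h; simp
      · simp [h]
    simp only [this]
    exact (lp.isometry_single i).continuous.comp (π.continuous_apply _)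
  · rw [dist_eq_norm, ← map_sub]
    refine (norm_lpMap_le _ _ _).trans_lt ?_
    rw [← dist_eq_norm, dist_comm]
    exact hn n le_rfl

/-- The `ℓ_p`-sum of countably many copies of a representation. -/
def IsoRep.lpRep (hp' : p < ⊤) (π : IsoRep G E) : IsoRep G (lp (fun _ : ℕ => E) p) :=
  IsoRep.ofContractions
    (fun x => lpMap p ((π x).toLinearEquiv : E →ₗ[ℂ] E) fun ξ => ((π x).norm_map ξ).le)
    (fun _ _ => norm_lpMap_le _ _ _) (fun f => by ext n; exact π.map_one_apply (f n))
    (fun x y f => by ext n; exact π.map_mul_apply x y (f n)) (π.continuous_lpMap p hp')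

/-! ### Hölder duality, and the collapse of an expansion to one coefficient. -/

variable {p} in
/-- Hölder's inequality for an `ℓ_p`-sum and an `ℓ_q`-sum of two different spaces. -/
theorem lp_tsum_norm_mul_le {F : Type w} [NormedAddCommGroup F] {q : ℝ≥0∞}
    (hpq : p.toReal.HolderConjugate q.toReal) (f : lp (fun _ : ℕ => E) p)
    (g : lp (fun _ : ℕ => F) q) :
    (Summable fun n => ‖f n‖ * ‖g n‖) ∧ ∑' n, ‖f n‖ * ‖g n‖ ≤ ‖f‖ * ‖g‖ := by
  obtain ⟨C, -, hC', hC⟩ := Real.inner_le_Lp_mul_Lq_hasSum_of_nonneg hpq (lp.norm_nonneg' f)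
    (lp.norm_nonneg' g) (fun n => norm_nonneg (f n)) (fun n => norm_nonneg (g n))
    (lp.hasSum_norm hpq.pos f) (lp.hasSum_norm hpq.symm.pos g)
  rw [← hC.tsum_eq] at hC'
  exact ⟨hC.summable, hC'⟩

variable {p} in
theorem summable_lp_apply {q : ℝ≥0∞} (hpq : p.toReal.HolderConjugate q.toReal)
    (g : lp (fun _ : ℕ => StrongDual ℂ E) q) (f : lp (fun _ : ℕ => E) p) :
    (Summable fun n => g n (f n)) ∧ ‖∑' n, g n (f n)‖ ≤ ‖g‖ * ‖f‖ := by
  have hle (n : ℕ) : ‖g n (f n)‖ ≤ ‖f n‖ * ‖g n‖ := by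
    rw [mul_comm]; exact (g n).le_opNorm (f n)
  obtain ⟨h1, h2⟩ := lp_tsum_norm_mul_le hpq f g
  refine ⟨h1.of_norm_bounded hle, (tsum_of_norm_bounded h1.hasSum hle).trans ?_⟩
  rwa [mul_comm]

variable {p} in
/-- The functional `f ↦ ∑ₙ ⟨fₙ, gₙ⟩` on an `ℓ_p`-sum given by an element `g` of the `ℓ_q`-sum of the
dual spaces. -/
def lpPairing {q : ℝ≥0∞} [Fact (1 ≤ q)] (hpq : p.toReal.HolderConjugate q.toReal)
    (g : lp (fun _ : ℕ => StrongDual ℂ E) q) : StrongDual ℂ (lp (fun _ : ℕ => E) p) :=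
  LinearMap.mkContinuous
    { toFun := fun f => ∑' n, g n (f n)
      map_add' := fun f f' => by
        rw [← (summable_lp_apply hpq g f).1.tsum_add (summable_lp_apply hpq g f').1]
        exact tsum_congr fun n => map_add (g n) (f n) (f' n)
      map_smul' := fun c f => by
        rw [RingHom.id_apply, smul_eq_mul, ← tsum_mul_left]
        exact tsum_congr fun n => map_smul (g n) c (f n) }
    ‖g‖ fun f => (summable_lp_apply hpq g f).2

theorem lpPairing_apply {q : ℝ≥0∞} [Fact (1 ≤ q)] (hpq : p.toReal.HolderConjugate q.toReal)
    (g : lp (fun _ : ℕ => StrongDual ℂ E) q) (f : lp (fun _ : ℕ => E) p) :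
    lpPairing hpq g f = ∑' n, g n (f n) := rfl

theorem norm_lpPairing_le {q : ℝ≥0∞} [Fact (1 ≤ q)] (hpq : p.toReal.HolderConjugate q.toReal)
    (g : lp (fun _ : ℕ => StrongDual ℂ E) q) : ‖lpPairing hpq g‖ ≤ ‖g‖ :=
  ContinuousLinearMap.opNorm_le_bound _ (norm_nonneg _) fun f => (summable_lp_apply hpq g f).2

/-- A vector and a functional can be rescaled so that the product of their norms is split between
them in the exponents of Hölder's inequality, without changing the coefficient function. -/
theorem exists_rescale {r s : ℝ} (hrs : r.HolderConjugate s) (ξ : E) (η : StrongDual ℂ E) :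
    ∃ (ξ' : E) (η' : StrongDual ℂ E), (∀ T : E →ₗ[ℂ] E, η' (T ξ') = η (T ξ)) ∧
      ‖ξ'‖ ^ r = ‖ξ‖ * ‖η‖ ∧ ‖η'‖ ^ s = ‖ξ‖ * ‖η‖ := by
  rcases eq_or_ne ξ 0 with rfl | hξ
  · exact ⟨0, 0, by simp, by simp [hrs.ne_zero], by simp [hrs.symm.ne_zero]⟩
  rcases eq_or_ne η 0 with rfl | hη
  · exact ⟨0, 0, by simp, by simp [hrs.ne_zero], by simp [hrs.symm.ne_zero]⟩
  have hξ' : 0 < ‖ξ‖ := norm_pos_iff.2 hξ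
  have hη' : 0 < ‖η‖ := norm_pos_iff.2 hη
  set c := ‖ξ‖ * ‖η‖ with hc
  have hc0 : 0 < c := by positivity
  set t : ℝ := c ^ r⁻¹ / ‖ξ‖ with ht
  have ht0 : 0 < t := by positivity
  have h1 : t * ‖ξ‖ = c ^ r⁻¹ := by rw [ht]; field_simp
  have h2 : t⁻¹ * ‖η‖ = c ^ s⁻¹ := by
    have : s⁻¹ = 1 - r⁻¹ := by have := hrs.inv_add_inv_eq_one; linarith
    rw [this, Real.rpow_sub hc0, Real.rpow_one, ht, inv_div, hc]
    ring
  refine ⟨(t : ℂ) • ξ, ((t⁻¹ : ℝ) : ℂ) • η, fun T => ?_, ?_, ?_⟩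
  · have : (t : ℂ) ≠ 0 := by exact_mod_cast ht0.ne'
    simp [this]
  · rw [norm_smul, Complex.norm_real, Real.norm_of_nonneg ht0.le, h1, ← Real.rpow_mul hc0.le,
      inv_mul_cancel₀ hrs.ne_zero, Real.rpow_one]
  · rw [norm_smul, Complex.norm_real, Real.norm_of_nonneg (inv_nonneg.2 ht0.le), h2,
      ← Real.rpow_mul hc0.le, inv_mul_cancel₀ hrs.symm.ne_zero, Real.rpow_one]

/-- A function in the Fourier space of `π` is a single coefficient function of the `ℓ_p`-sum of
copies of `π`, at no higher cost. -/
theorem IsoRep.exists_lpRep_coefficient (hp : 1 < p) (hp' : p < ⊤) (π : IsoRep G E) {u : G → ℂ}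
    {r : ℝ} (hr : r ∈ π.costs u) :
    ∃ (f : lp (fun _ : ℕ => E) p) (η : StrongDual ℂ (lp (fun _ : ℕ => E) p)),
      (∀ x, η (π.lpRep p hp' x f) = u x) ∧ ‖f‖ * ‖η‖ ≤ r := by
  obtain ⟨ξ, η, ⟨h1, h2⟩, rfl⟩ := hr
  have hp1 : 1 < p.toReal := by
    rw [← ENNReal.toReal_one]; exact (ENNReal.toReal_lt_toReal ENNReal.one_ne_top hp'.ne).2 hp
  have hconj := Real.HolderConjugate.conjExponent hp1
  set s := p.toReal.conjExponent
  let q : ℝ≥0∞ := ENNReal.ofReal s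
  have hq : q.toReal = s := ENNReal.toReal_ofReal hconj.symm.nonneg
  have : Fact (1 ≤ q) := ⟨by
    rw [← ENNReal.ofReal_one]; exact ENNReal.ofReal_le_ofReal hconj.symm.lt.le⟩
  choose ξ' η' hT hξ hη using fun n => exists_rescale hconj (ξ n) (η n)
  rw [← hq] at hconj
  -- After rescaling, `‖ξ' n‖ ^ p` and `‖η' n‖ ^ q` both equal the cost of the `n`-th term, so the
  -- norms of `f` and `g` multiply to the total cost.
  let f : lp (fun _ : ℕ => E) p := ⟨ξ', memℓp_gen (by simpa only [hξ] using h1)⟩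
  let g : lp (fun _ : ℕ => StrongDual ℂ E) q :=
    ⟨η', memℓp_gen (by simpa only [hq, hη] using h1)⟩
  set c := ∑' n, ‖ξ n‖ * ‖η n‖
  have hc0 : 0 ≤ c := tsum_nonneg fun n => by positivity
  have hf : ‖f‖ = c ^ (1 / p.toReal) := by
    rw [lp.norm_eq_tsum_rpow hconj.pos]
    exact congrArg (· ^ (1 / p.toReal)) (tsum_congr hξ)
  have hg : ‖g‖ = c ^ (1 / q.toReal) := by
    rw [lp.norm_eq_tsum_rpow hconj.symm.pos]
    exact congrArg (· ^ (1 / q.toReal)) (tsum_congr fun n => by rw [hq]; exact hη n)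
  refine ⟨f, lpPairing hconj g, fun x => ?_, ?_⟩
  · rw [lpPairing_apply, ← (h2 x).tsum_eq]
    exact tsum_congr fun n => hT n ((π x).toLinearEquiv : E →ₗ[ℂ] E)
  · calc ‖f‖ * ‖lpPairing hconj g‖ ≤ ‖f‖ * ‖g‖ := by
          gcongr; exact norm_lpPairing_le p hconj g
      _ = c ^ (1 / p.toReal + 1 / q.toReal) := by
          rw [hf, hg, ← Real.rpow_add_of_nonneg hc0 (by positivity) (by positivity)]
      _ = c := by rw [one_div, one_div, hconj.inv_add_inv_eq_one, Real.rpow_one]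

end Constructions

/-! ### Coefficient functions that are constant on cosets -/

section Cosets

variable {G : Type u} [Group G] [TopologicalSpace G] (N : Subgroup G) [N.Normal]
variable {E : Type u} [NormedAddCommGroup E] [NormedSpace ℂ E] [CompleteSpace E]
variable (p : ℝ≥0∞) [Fact (1 ≤ p)]

/-- A coefficient function of `π` that is constant on the cosets of `N` is a coefficient function of
a representation of `G ⧸ N`. -/
theorem IsoRep.exists_quotient_coefficient (π : IsoRep G E) (hπ : InRep p π)
    (ξ : E) (η : StrongDual ℂ E) (u : G ⧸ N → ℂ) (hu : ∀ x, η (π x ξ) = u (x : G ⧸ N)) :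
    ∃ (F : Type u) (_ : NormedAddCommGroup F) (_ : NormedSpace ℂ F) (_ : CompleteSpace F)
      (ρ : IsoRep (G ⧸ N) F) (ξ' : F) (η' : StrongDual ℂ F), InRep p ρ ∧
      (∀ y, η' (ρ y ξ') = u y) ∧ ‖ξ'‖ * ‖η'‖ ≤ ‖ξ‖ * ‖η‖ := by
  -- `M` is the largest `G`-invariant subspace of `ker η`; dividing by it keeps every coefficient
  -- against `η`.
  let M : Submodule ℂ E :=
    { carrier := {ζ | ∀ x, η (π x ζ) = 0}
      add_mem' := fun ha hb x => by rw [map_add, map_add, ha x, hb x, add_zero]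
      zero_mem' := fun x => by rw [map_zero, map_zero]
      smul_mem' := fun c ζ h x => by rw [map_smul, map_smul, h x, smul_zero] }
  have hMc : IsClosed (M : Set E) := by
    have : (M : Set E) = ⋂ x, {ζ | η (π x ζ) = 0} := by ext; simp [M]
    rw [this]
    exact isClosed_iInter fun x => isClosed_eq (η.continuous.comp (π x).continuous)
      continuous_const
  have hM : ∀ (x : G), ∀ ζ ∈ M, π x ζ ∈ M := fun x ζ h y => by
    rw [← π.map_mul_apply]; exact h (y * x)
  let τ := π.quotientRep M hM
  have hle : ∀ ζ ∈ M, η ζ = 0 := fun ζ h => by simpa only [π.map_one_apply] using h 1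
  have hker : M ≤ LinearMap.ker (η : E →ₗ[ℂ] ℂ) := fun ζ h => hle ζ h
  let η₁ : StrongDual ℂ (E ⧸ M) := (M.liftQ (η : E →ₗ[ℂ] ℂ) hker).mkContinuous ‖η‖ fun z => by
    refine le_of_forall_pos_le_add fun ε hε => ?_
    obtain ⟨m, rfl, hm⟩ := Submodule.Quotient.norm_mk_lt z
      (show 0 < ε / (‖η‖ + 1) by positivity)
    refine (η.le_opNorm m).trans ?_
    have h2 : ‖η‖ * (ε / (‖η‖ + 1)) ≤ ε := by
      rw [mul_div_assoc', div_le_iff₀ (by positivity)]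
      nlinarith [norm_nonneg η]
    nlinarith [norm_nonneg η]
  have hη₁ : ‖η₁‖ ≤ ‖η‖ := LinearMap.mkContinuous_norm_le _ (norm_nonneg _) _
  -- Constancy of `u ∘ q` on cosets says that `η(π(xn)ξ) = η(π(x)ξ)` for all `x`, that is, `π(n)ξ -
  -- ξ ∈ M`.
  have hξ : (Submodule.Quotient.mk ξ : E ⧸ M) ∈ τ.fixedVectors N := fun n hn => by
    refine (Submodule.Quotient.eq _).2 fun x => ?_
    change η (π x (π n ξ - ξ)) = 0
    rw [map_sub, map_sub, ← π.map_mul_apply, hu, hu, sub_eq_zero]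
    congr 1
    exact (QuotientGroup.mk_mul_of_mem x hn)
  have hK := τ.isClosed_fixedVectors N
  refine ⟨τ.fixedVectors N, inferInstance, inferInstance, hK.completeSpace_coe, τ.fixedRep N,
    ⟨_, hξ⟩, η₁.comp (τ.fixedVectors N).subtypeL,
    IsQSL.submodule (IsQSL.quotient hπ M) _ hK, fun y => ?_, ?_⟩
  · obtain ⟨x, rfl⟩ := QuotientGroup.mk_surjective y
    exact hu x
  · gcongr
    · exact Submodule.Quotient.norm_mk_le M ξ
    · refine (ContinuousLinearMap.opNorm_comp_le _ _).trans ?_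
      calc ‖η₁‖ * ‖(τ.fixedVectors N).subtypeL‖ ≤ ‖η‖ * 1 := by
            gcongr; exact Submodule.norm_subtypeL_le _
        _ = ‖η‖ := mul_one _

end Cosets

/-! ### The operators of a representation -/

section Operators

variable {G : Type u} [Group G] [TopologicalSpace G]
variable {E : Type v} [NormedAddCommGroup E] [NormedSpace ℂ E]

/-- The operator `π(x)`, as a bounded linear map. -/
def IsoRep.op (π : IsoRep G E) (x : G) : E →L[ℂ] E :=
  ((π x).toContinuousLinearEquiv : E →L[ℂ] E)

@[simp]
theorem IsoRep.op_apply (π : IsoRep G E) (x : G) (ξ : E) : π.op x ξ = π x ξ := rfl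

theorem IsoRep.norm_op_le (π : IsoRep G E) (x : G) : ‖π.op x‖ ≤ 1 :=
  ContinuousLinearMap.opNorm_le_bound _ zero_le_one fun ξ => by simp

variable [IsTopologicalGroup G]

/-- Homogeneity: `π(x)T = π(y) π(y⁻¹x)T` carries continuity at `1` to any point `y`. -/
theorem IsoRep.continuous_op_comp (π : IsoRep G E) (T : E →L[ℂ] E)
    (h : ContinuousAt (fun x => (π.op x).comp T) 1) : Continuous fun x => (π.op x).comp T := by
  refine continuous_iff_continuousAt.2 fun y => ?_
  have e : (fun x => (π.op x).comp T) =
      (fun S => (π.op y).comp S) ∘ (fun x => (π.op x).comp T) ∘ fun x => y⁻¹ * x := by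
    funext x
    ext ξ
    simp
  rw [e]
  refine ContinuousAt.comp (continuous_const.clm_comp continuous_id).continuousAt
    (ContinuousAt.comp ?_ (continuous_const_mul _).continuousAt)
  rwa [inv_mul_cancel]

theorem IsoRep.continuous_comp_op (π : IsoRep G E) (T : E →L[ℂ] E)
    (h : ContinuousAt (fun x => T.comp (π.op x)) 1) : Continuous fun x => T.comp (π.op x) := by
  refine continuous_iff_continuousAt.2 fun y => ?_
  have e : (fun x => T.comp (π.op x)) =
      (fun S => S.comp (π.op y)) ∘ (fun x => T.comp (π.op x)) ∘ fun x => x * y⁻¹ := by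
    funext x
    ext ξ
    simp
  rw [e]
  refine ContinuousAt.comp (continuous_id.clm_comp continuous_const).continuousAt
    (ContinuousAt.comp ?_ (continuous_mul_const _).continuousAt)
  rwa [mul_inv_cancel]

end Operators

/-! ### Operators given by integrable functions -/

section Integrated

open MeasureTheory Topology Filter

variable {G : Type u} [Group G] [TopologicalSpace G] [IsTopologicalGroup G] [LocallyCompactSpace G]
variable [MeasurableSpace G] [BorelSpace G] {μ : Measure G}
variable {E : Type v} [NormedAddCommGroup E] [NormedSpace ℂ E]

theorem integratedWith_toL1 [μ.Regular] (π : IsoRep G E) {f : G → ℂ} (hf : Integrable f μ) (ξ : E) :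
    integratedWith μ π (hf.toL1 f) ξ = ∫ x, f x • π x ξ ∂μ := by
  change ∫ x, (hf.toL1 f) x • π x ξ ∂μ = _
  refine integral_congr_ae ?_
  filter_upwards [hf.coeFn_toL1] with x hx
  rw [hx]

theorem norm_integratedWith_le [μ.Regular] (π : IsoRep G E) (f : Lp ℂ 1 μ) :
    ‖integratedWith μ π f‖ ≤ ‖f‖ :=
  ContinuousLinearMap.opNorm_le_bound _ (norm_nonneg _) fun ξ => by
    refine (norm_integral_le_integral_norm fun x => f x • π x ξ).trans ?_
    simp only [norm_smul, LinearIsometryEquiv.norm_map]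
    rw [integral_mul_const, L1.norm_eq_integral_norm]

theorem norm_integratedWith_toL1_sub_le [μ.Regular] (π : IsoRep G E) {f g : G → ℂ}
    (hf : Integrable f μ) (hg : Integrable g μ) :
    ‖integratedWith μ π (hf.toL1 f) - integratedWith μ π (hg.toL1 g)‖ ≤ ∫ x, ‖f x - g x‖ ∂μ := by
  rw [← map_sub, ← Integrable.toL1_sub]
  refine (norm_integratedWith_le π _).trans_eq ?_
  rw [L1.norm_eq_integral_norm]
  refine integral_congr_ae ?_
  filter_upwards [(hf.sub hg).coeFn_toL1] with x hx
  rw [hx, Pi.sub_apply]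

/-- Normalized nonnegative functions concentrated near a point. -/
theorem exists_bump (μ : Measure G) [IsFiniteMeasureOnCompacts μ] [μ.IsOpenPosMeasure] {x : G}
    {U : Set G} (hU : U ∈ 𝓝 x) :
    ∃ f : G → ℝ, Continuous f ∧ HasCompactSupport f ∧ (∀ y, 0 ≤ f y) ∧ (∀ y, f y ≠ 0 → y ∈ U) ∧
      ∫ y, f y ∂μ = 1 := by
  obtain ⟨f, h1, h2, h3, h4⟩ := exists_continuousMap_one_of_isCompact_subset_isOpen
    (isCompact_singleton (x := x)) isOpen_interior
    (Set.singleton_subset_iff.2 (mem_interior_iff_mem_nhds.2 hU))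
  have hpos : 0 < ∫ y, f y ∂μ := f.continuous.integral_pos_of_hasCompactSupport_nonneg_nonzero h2
    (fun y => (h4 y).1) (x := x) (by rw [h1 rfl]; simp)
  refine ⟨fun y => (∫ y, f y ∂μ)⁻¹ * f y, by fun_prop, HasCompactSupport.mul_left h2,
    fun y => mul_nonneg (inv_nonneg.2 hpos.le) (h4 y).1, fun y hy => ?_, ?_⟩
  · exact interior_subset (h3 (subset_tsupport _ (right_ne_zero_of_mul hy)))
  · rw [integral_const_mul, inv_mul_cancel₀ hpos.ne']

/-- Density of the continuous functions with compact support in `L_1(G)`, without a normality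
assumption. -/
theorem exists_hasCompactSupport_integral_norm_sub_le [μ.Regular] {f : G → ℂ}
    (hf : Integrable f μ) {ε : ℝ} (hε : 0 < ε) :
    ∃ g : G → ℂ, Continuous g ∧ HasCompactSupport g ∧ ∫ x, ‖f x - g x‖ ∂μ ≤ ε := by
  have key : ∀ (c : ℂ) ⦃t : Set G⦄, MeasurableSet t → μ t < ⊤ → ∀ {ε : ℝ≥0∞}, ε ≠ 0 →
      ∃ g : G → ℂ, eLpNorm (g - t.indicator fun _ => c) 1 μ ≤ ε ∧
        Continuous g ∧ HasCompactSupport g := by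
    intro c t ht htμ ε hε
    -- The function `φ` cuts off from a compact `K ⊆ t` to an open `V ⊇ K`, so `φ` differs from the
    -- indicator of `t` only on `V \ K` and `t \ K`, each of measure at most `δ`. The summand `1`
    -- keeps the denominator nonzero.
    set δ : ℝ≥0∞ := ε / (2 * (‖c‖ₑ + 1))
    have hδ0 : δ ≠ 0 := (ENNReal.div_pos hε
      (ENNReal.mul_ne_top ENNReal.ofNat_ne_top (by simp))).ne'
    obtain ⟨K, hKt, hK, hKc, hKμ⟩ := ht.exists_isCompact_isClosed_sdiff_lt htμ.ne hδ0
    obtain ⟨V, hKV, hV, hVμ⟩ := hK.exists_isOpen_lt_add (μ := μ) hδ0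
    obtain ⟨φ, h1, h2, h3, h4⟩ := exists_continuousMap_one_of_isCompact_subset_isOpen hK hV hKV
    have hVK : μ (V \ K) ≤ δ := by
      rw [measure_sdiff hKV hKc.measurableSet.nullMeasurableSet hK.measure_ne_top]
      exact tsub_le_iff_left.2 hVμ.le
    refine ⟨fun x => (φ x : ℂ) * c, ?_, by fun_prop,
      HasCompactSupport.mul_right (HasCompactSupport.comp_left h2 Complex.ofReal_zero)⟩
    rw [eLpNorm_one_eq_lintegral_enorm]
    calc ∫⁻ x, ‖((fun x => (φ x : ℂ) * c) - t.indicator fun _ => c) x‖ₑ ∂μ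
        ≤ ∫⁻ x, ((V \ K) ∪ (t \ K)).indicator (fun _ => ‖c‖ₑ) x ∂μ := by
          refine lintegral_mono fun x => ?_
          rw [Pi.sub_apply]
          have hφ0 : x ∉ V → φ x = 0 := fun h => by
            by_contra h'
            exact h (h3 (subset_tsupport _ h'))
          by_cases hx : x ∈ (V \ K) ∪ (t \ K)
          · rw [Set.indicator_of_mem hx, enorm_le_iff_norm_le]
            obtain ⟨ha, hb⟩ := h4 x
            by_cases hxt : x ∈ t
            · rw [Set.indicator_of_mem hxt]
              have : (φ x : ℂ) * c - c = ((φ x - 1 : ℝ) : ℂ) * c := by push_cast; ring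
              rw [this, norm_mul, Complex.norm_real]
              refine mul_le_of_le_one_left (norm_nonneg c) ?_
              rw [Real.norm_eq_abs, abs_le]
              constructor <;> linarith
            · rw [Set.indicator_of_notMem hxt, sub_zero, norm_mul, Complex.norm_real]
              refine mul_le_of_le_one_left (norm_nonneg c) ?_
              rwa [Real.norm_of_nonneg ha]
          · rw [Set.indicator_of_notMem hx]
            by_cases hxK : x ∈ K
            · rw [Set.indicator_of_mem (hKt hxK), h1 hxK]
              simp
            · have hxV : x ∉ V := fun h => hx (Or.inl ⟨h, hxK⟩)
              have hxt : x ∉ t := fun h => hx (Or.inr ⟨h, hxK⟩)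
              rw [Set.indicator_of_notMem hxt, hφ0 hxV]
              simp
      _ = ‖c‖ₑ * μ ((V \ K) ∪ (t \ K)) :=
          lintegral_indicator_const ((hV.measurableSet.diff hKc.measurableSet).union
            (ht.diff hKc.measurableSet)) _
      _ ≤ (‖c‖ₑ + 1) * (δ + δ) := by
          gcongr
          · exact le_self_add
          · exact (measure_union_le _ _).trans (add_le_add hVK hKμ.le)
      _ = 2 * (‖c‖ₑ + 1) * δ := by ring
      _ ≤ ε := ENNReal.mul_div_le
  obtain ⟨g, hfg, hg, hgc⟩ := (memLp_one_iff_integrable.2 hf).induction_dense ENNReal.one_ne_top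
    (fun g : G → ℂ => Continuous g ∧ HasCompactSupport g) key
    (fun f g hf hg => ⟨hf.1.add hg.1, hf.2.add hg.2⟩)
    (fun f hf => (hf.1.integrable_of_hasCompactSupport hf.2).aestronglyMeasurable)
    (ENNReal.ofReal_pos.2 hε).ne'
  have hgi := hg.integrable_of_hasCompactSupport (μ := μ) hgc
  refine ⟨g, hg, hgc, ?_⟩
  rw [eLpNorm_one_eq_lintegral_enorm] at hfg
  refine (integral_norm_eq_lintegral_enorm (hf.sub hgi).aestronglyMeasurable).trans_le ?_
  exact ENNReal.toReal_le_of_le_ofReal hε.le hfg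

/-- Averages of a function near a point are close to the value at that point. -/
theorem norm_integral_bump_sub_le {V : Type*} [NormedAddCommGroup V] [NormedSpace ℂ V]
    [CompleteSpace V] {f : G → ℝ} {φ : G → V} {v : V} {C : ℝ}
    (hf : Integrable f μ) (h0 : ∀ y, 0 ≤ f y) (h1 : ∫ y, f y ∂μ = 1)
    (hφ : Integrable (fun y => (f y : ℂ) • φ y) μ) (hC : ∀ y, f y ≠ 0 → ‖φ y - v‖ ≤ C) :
    ‖∫ y, (f y : ℂ) • φ y ∂μ - v‖ ≤ C := by
  have e : ∫ y, (f y : ℂ) • v ∂μ = v := by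
    rw [integral_smul_const, integral_complex_ofReal, h1, Complex.ofReal_one, one_smul]
  have hfv : Integrable (fun y => (f y : ℂ) • v) μ := hf.ofReal.smul_const v
  calc ‖∫ y, (f y : ℂ) • φ y ∂μ - v‖ = ‖∫ y, ((f y : ℂ) • φ y - (f y : ℂ) • v) ∂μ‖ := by
        rw [integral_sub hφ hfv, e]
    _ ≤ ∫ y, f y * C ∂μ := by
        refine norm_integral_le_of_norm_le (hf.mul_const C) (Eventually.of_forall fun y => ?_)
        rw [← smul_sub, norm_smul, Complex.norm_real, Real.norm_of_nonneg (h0 y)]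
        rcases eq_or_ne (f y) 0 with h | h
        · simp [h]
        · exact mul_le_mul_of_nonneg_left (hC y h) (h0 y)
    _ = C := by rw [integral_mul_const, h1, one_mul]

/-- A weighted integral of a bounded continuous function with values in a closed subspace lies in
that subspace. -/
theorem integral_smul_mem [μ.Regular] {V : Type*} [NormedAddCommGroup V] [NormedSpace ℂ V]
    [CompleteSpace V] (A : Submodule ℂ V) (hA : IsClosed (A : Set V)) {f : G → ℂ}
    (hf : Integrable f μ) {φ : G → V} (hφ : Continuous φ) {C : ℝ} (hC : ∀ x, ‖φ x‖ ≤ C)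
    (hm : ∀ x, φ x ∈ A) :
    Integrable (fun x => f x • φ x) μ ∧ ∫ x, f x • φ x ∂μ ∈ A := by
  have : CompleteSpace A := hA.completeSpace_coe
  -- The integral is formed in `A`, itself a Banach space, and then carried to `V` by the inclusion.
  let ψ : G → A := fun x => ⟨φ x, hm x⟩
  have hψ : Continuous ψ := hφ.subtype_mk _
  have hi : Integrable (fun x => f x • ψ x) μ := by
    refine (hf.norm.mul_const C).mono' (aestronglyMeasurable_smul μ hf hψ) ?_
    filter_upwards with x
    rw [norm_smul]
    exact mul_le_mul_of_nonneg_left (hC x) (norm_nonneg _)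
  refine ⟨A.subtypeL.integrable_comp hi, ?_⟩
  have := A.subtypeL.integral_comp_comm hi
  change ∫ x, f x • φ x ∂μ = _ at this
  rw [this]
  exact (∫ x, f x • ψ x ∂μ : A).2

/-! ### Translations -/

variable [μ.IsHaarMeasure] [μ.Regular]

/-- For `y` in a compact neighbourhood `t` of `1`, all the integrands vanish off the compact set `t
* tsupport f`, so the integral depends continuously on `y`. -/
theorem continuousAt_integral_norm_translate_left {f : G → ℂ} (hf : Continuous f)
    (hfc : HasCompactSupport f) :
    Tendsto (fun y => ∫ x, ‖f (y⁻¹ * x) - f x‖ ∂μ) (𝓝 1) (𝓝 0) := by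
  obtain ⟨t, htc, ht⟩ := exists_compact_mem_nhds (1 : G)
  have h1 : (1 : G) ∈ t := mem_of_mem_nhds ht
  have A : ContinuousOn (fun y => ∫ x, ‖f (y⁻¹ * x) - f x‖ ∂μ) t := by
    apply continuousOn_integral_of_compact_support (htc.mul hfc)
    · have : Continuous (Function.uncurry fun y x : G => ‖f (y⁻¹ * x) - f x‖) := by
        simp only [Function.uncurry_def]; fun_prop
      exact this.continuousOn
    · intro y x hy hx
      have e1 : f (y⁻¹ * x) = 0 := by
        by_contra h
        exact hx ⟨y, hy, y⁻¹ * x, subset_tsupport _ h, by simp⟩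
      have e2 : f x = 0 := by
        by_contra h
        exact hx ⟨1, h1, x, subset_tsupport _ h, by simp⟩
      simp [e1, e2]
  simpa [ContinuousAt] using (A.continuousAt ht).tendsto

theorem continuousAt_integral_norm_translate_right {f : G → ℂ} (hf : Continuous f)
    (hfc : HasCompactSupport f) :
    Tendsto (fun y => ∫ x, ‖f (x * y⁻¹) - f x‖ ∂μ) (𝓝 1) (𝓝 0) := by
  obtain ⟨t, htc, ht⟩ := exists_compact_mem_nhds (1 : G)
  have h1 : (1 : G) ∈ t := mem_of_mem_nhds ht
  have A : ContinuousOn (fun y => ∫ x, ‖f (x * y⁻¹) - f x‖ ∂μ) t := by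
    apply continuousOn_integral_of_compact_support (hfc.mul htc)
    · have : Continuous (Function.uncurry fun y x : G => ‖f (x * y⁻¹) - f x‖) := by
        simp only [Function.uncurry_def]; fun_prop
      exact this.continuousOn
    · intro y x hy hx
      have e1 : f (x * y⁻¹) = 0 := by
        by_contra h
        exact hx ⟨x * y⁻¹, subset_tsupport _ h, y, hy, by simp⟩
      have e2 : f x = 0 := by
        by_contra h
        exact hx ⟨x, subset_tsupport _ h, 1, h1, by simp⟩
      simp [e1, e2]
  simpa [ContinuousAt] using (A.continuousAt ht).tendsto

/-- A right translate of a left Haar measure is left invariant, hence a multiple of `μ` by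
uniqueness. The factor plays the role of the modular function. -/
theorem integral_comp_mul_right (y : G) {V : Type*} [NormedAddCommGroup V] [NormedSpace ℝ V]
    (h : G → V) :
    ∫ x, h (x * y) ∂μ = Measure.haarScalarFactor (μ.map (· * y)) μ • ∫ x, h x ∂μ := by
  have : (μ.map (· * y)).Regular := Measure.Regular.map (Homeomorph.mulRight y)
  have e := Measure.isMulLeftInvariant_eq_smul_of_regular (μ.map (· * y)) μ
  rw [← integral_smul_nnreal_measure, ← e]
  exact ((Homeomorph.mulRight y).measurableEmbedding.integral_map h).symm

variable (μ) in
theorem tendsto_haarScalarFactor_map_mul_right :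
    Tendsto (fun y : G => (Measure.haarScalarFactor (μ.map (· * y)) μ : ℝ)) (𝓝 1) (𝓝 1) := by
  -- Since `f` has integral `1`, the factor at `y` is `∫ f(xy) dμ(x)`, whose continuity is that of a
  -- compactly supported integral.
  obtain ⟨f, hf, hfc, hf0, -, hf1⟩ := exists_bump μ (x := (1 : G)) univ_mem
  have e : ∀ y : G, (Measure.haarScalarFactor (μ.map (· * y)) μ : ℝ) = ∫ x, f (x * y) ∂μ := by
    intro y
    rw [integral_comp_mul_right, hf1, NNReal.smul_def, smul_eq_mul, mul_one]
  simp only [e]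
  obtain ⟨t, htc, ht⟩ := exists_compact_mem_nhds (1 : G)
  have A : ContinuousOn (fun y => ∫ x, f (x * y) ∂μ) t := by
    apply continuousOn_integral_of_compact_support (IsCompact.mul hfc htc.inv)
    · have : Continuous (Function.uncurry fun y x : G => f (x * y)) := by
        simp only [Function.uncurry_def]; fun_prop
      exact this.continuousOn
    · intro y x hy hx
      by_contra h
      exact hx ⟨x * y, subset_tsupport _ h, y⁻¹, Set.inv_mem_inv.2 hy, by simp⟩
  simpa [ContinuousAt, hf1] using (A.continuousAt ht).tendsto

theorem op_comp_integratedWith [CompleteSpace E] (π : IsoRep G E) {f : G → ℂ} (hf : Integrable f μ)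
    (y : G) : (π.op y).comp (integratedWith μ π (hf.toL1 f)) =
      integratedWith μ π ((hf.comp_mul_left y⁻¹).toL1 _) := by
  ext ξ
  rw [integratedWith_toL1, ContinuousLinearMap.comp_apply, integratedWith_toL1,
    ← ContinuousLinearMap.integral_comp_comm _ (integrable_smul_rep μ π hf ξ),
    ← integral_mul_left_eq_self (fun x => f (y⁻¹ * x) • π x ξ) y]
  simp only [inv_mul_cancel_left, map_smul, π.op_apply, π.map_mul_apply]

theorem integrable_comp_mul_right {f : G → ℂ} (hf : Continuous f) (hfc : HasCompactSupport f)
    (y : G) : Integrable (fun x => f (x * y)) μ :=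
  (hf.comp (continuous_mul_const y)).integrable_of_hasCompactSupport
    (hfc.comp_homeomorph (Homeomorph.mulRight y))

theorem integratedWith_comp_op (π : IsoRep G E) {f : G → ℂ} (hf : Continuous f)
    (hfc : HasCompactSupport f) (y : G) :
    (integratedWith μ π ((hf.integrable_of_hasCompactSupport hfc).toL1 f)).comp (π.op y) =
      ((Measure.haarScalarFactor (μ.map (· * y)) μ : ℝ) : ℂ) •
        integratedWith μ π ((integrable_comp_mul_right hf hfc y⁻¹).toL1 _) := by
  ext ξ
  rw [ContinuousLinearMap.comp_apply, integratedWith_toL1, smul_apply,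
    integratedWith_toL1]
  have := integral_comp_mul_right (μ := μ) y fun x => f (x * y⁻¹) • π x ξ
  simp only [mul_inv_cancel_right, π.map_mul_apply] at this
  simp only [π.op_apply, this]
  rfl

theorem continuous_op_comp_integratedWith [CompleteSpace E] (π : IsoRep G E) {f : G → ℂ}
    (hf : Continuous f) (hfc : HasCompactSupport f) : Continuous fun y =>
      (π.op y).comp (integratedWith μ π ((hf.integrable_of_hasCompactSupport hfc).toL1 f)) := by
  refine π.continuous_op_comp _ ?_
  have h1 : π.op 1 = ContinuousLinearMap.id ℂ E := by ext ξ; exact π.map_one_apply ξ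
  rw [ContinuousAt, h1, ContinuousLinearMap.id_comp, tendsto_iff_norm_sub_tendsto_zero]
  refine squeeze_zero (fun _ => norm_nonneg _) (fun y => ?_)
    (continuousAt_integral_norm_translate_left (μ := μ) hf hfc)
  rw [op_comp_integratedWith]
  exact norm_integratedWith_toL1_sub_le π _ _

theorem continuous_integratedWith_comp_op (π : IsoRep G E) {f : G → ℂ}
    (hf : Continuous f) (hfc : HasCompactSupport f) : Continuous fun y =>
      (integratedWith μ π ((hf.integrable_of_hasCompactSupport hfc).toL1 f)).comp (π.op y) := by
  refine π.continuous_comp_op _ ?_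
  have h1 : π.op 1 = ContinuousLinearMap.id ℂ E := by ext ξ; exact π.map_one_apply ξ
  rw [ContinuousAt, h1, ContinuousLinearMap.comp_id]
  simp only [integratedWith_comp_op π hf hfc]
  have h2 : Tendsto (fun y : G => integratedWith μ π
      ((integrable_comp_mul_right hf hfc y⁻¹).toL1 _)) (𝓝 1)
      (𝓝 (integratedWith μ π ((hf.integrable_of_hasCompactSupport hfc).toL1 f))) := by
    rw [tendsto_iff_norm_sub_tendsto_zero]
    exact squeeze_zero (fun _ => norm_nonneg _)
      (fun y => norm_integratedWith_toL1_sub_le π _ _)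
      (continuousAt_integral_norm_translate_right (μ := μ) hf hfc)
  have h3 := (Complex.continuous_ofReal.tendsto 1).comp
    (tendsto_haarScalarFactor_map_mul_right μ)
  simpa using h3.smul h2

/-- The operators `π(f)` form an approximate unit for the operators on which `G` acts
continuously. -/
theorem exists_norm_integratedWith_comp_sub_le [CompleteSpace E] (π : IsoRep G E) (T : E →L[ℂ] E)
    (hT : Continuous fun x => (π.op x).comp T) {ε : ℝ} (hε : 0 < ε) :
    ∃ (f : G → ℂ) (hf : Continuous f) (hfc : HasCompactSupport f),
      ‖(integratedWith μ π ((hf.integrable_of_hasCompactSupport hfc).toL1 f)).comp T - T‖ ≤ ε := by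
  have h1 : (π.op 1).comp T = T := by ext ξ; exact π.map_one_apply _
  have hU : {x | ‖(π.op x).comp T - T‖ ≤ ε} ∈ 𝓝 (1 : G) := by
    have hc : ContinuousAt (fun x => ‖(π.op x).comp T - T‖) 1 :=
      (hT.sub continuous_const).norm.continuousAt
    refine hc.tendsto.eventually_le_const ?_
    rwa [h1, sub_self, norm_zero]
  obtain ⟨f, hf, hfc, hf0, hfU, hf1⟩ := exists_bump μ hU
  have hi := hf.integrable_of_hasCompactSupport (μ := μ) hfc
  refine ⟨fun x => (f x : ℂ), by fun_prop, hfc.comp_left Complex.ofReal_zero,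
    ContinuousLinearMap.opNorm_le_bound _ hε.le fun ξ => ?_⟩
  -- The average is compared with the value `Tξ` for each `ξ`; the bound `ε‖ξ‖` holds throughout the
  -- support of `f`.
  rw [sub_apply, ContinuousLinearMap.comp_apply, integratedWith_toL1]
  refine norm_integral_bump_sub_le hi hf0 hf1 (integrable_smul_rep μ π hi.ofReal _) fun y hy => ?_
  exact (((π.op y).comp T - T).le_opNorm ξ).trans
    (mul_le_mul_of_nonneg_right (hfU y hy) (norm_nonneg ξ))

/-- Norm continuity of `x ↦ Sπ(x)` turns `Sπ(f)` into the operator-valued integral `∫ f(x) Sπ(x)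
dx`, which a closed subspace containing every `Sπ(x)` must contain. -/
theorem comp_integratedWith_mem [CompleteSpace E] (π : IsoRep G E) (S : E →L[ℂ] E)
    (hS : Continuous fun x => S.comp (π.op x)) (A : Submodule ℂ (E →L[ℂ] E))
    (hA : IsClosed (A : Set (E →L[ℂ] E))) (hm : ∀ x, S.comp (π.op x) ∈ A) {f : G → ℂ}
    (hf : Integrable f μ) : S.comp (integratedWith μ π (hf.toL1 f)) ∈ A := by
  obtain ⟨hi, hmem⟩ := integral_smul_mem A hA hf hS (C := ‖S‖) (fun x =>
    (S.opNorm_comp_le _).trans (mul_le_of_le_one_right (norm_nonneg S) (π.norm_op_le x))) hm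
  convert hmem
  ext ξ
  rw [ContinuousLinearMap.comp_apply, integratedWith_toL1,
    ← ContinuousLinearMap.integral_comp_comm _ (integrable_smul_rep μ π hf ξ),
    ContinuousLinearMap.integral_apply hi]
  simp

/-- The closure of the operators given by integrable functions is generated by continuous functions
with compact support. -/
theorem topologicalClosure_range_integratedWith_le (π : IsoRep G E) (A : Submodule ℂ (E →L[ℂ] E))
    (hA : IsClosed (A : Set (E →L[ℂ] E)))
    (h : ∀ (f : G → ℂ) (hf : Continuous f) (hfc : HasCompactSupport f),
      integratedWith μ π ((hf.integrable_of_hasCompactSupport hfc).toL1 f) ∈ A) :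
    (LinearMap.range (integratedWith μ π)).topologicalClosure ≤ A := by
  refine Submodule.topologicalClosure_minimal _ ?_ hA
  rintro _ ⟨f, rfl⟩
  refine hA.closure_subset (Metric.mem_closure_iff.2 fun ε hε => ?_)
  have hf := L1.integrable_coeFn f
  obtain ⟨g, hg, hgc, hfg⟩ := exists_hasCompactSupport_integral_norm_sub_le hf (half_pos hε)
  have hgi := hg.integrable_of_hasCompactSupport (μ := μ) hgc
  refine ⟨_, h g hg hgc, ?_⟩
  have := norm_integratedWith_toL1_sub_le π hf hgi
  rw [Integrable.toL1_coeFn] at this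
  rw [dist_eq_norm]
  linarith

/-- Two representations on the same space with the same operators and the same continuous orbit maps
have the same pseudofunctions; this is one of the two inclusions. -/
theorem topologicalClosure_range_integratedWith_mono [CompleteSpace E] {H : Type w} [Group H]
    [TopologicalSpace H] [IsTopologicalGroup H] [LocallyCompactSpace H] [MeasurableSpace H]
    [BorelSpace H] {ν : Measure H} [ν.IsHaarMeasure] [ν.Regular]
    (π : IsoRep G E) (ρ : IsoRep H E)
    (hl : ∀ T : E →L[ℂ] E, Continuous (fun x => (π.op x).comp T) →
      Continuous fun y => (ρ.op y).comp T)
    (hr : ∀ S : E →L[ℂ] E, Continuous (fun y => S.comp (ρ.op y)) →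
      Continuous fun x => S.comp (π.op x))
    (hm : ∀ x, ∃ y, π.op x = ρ.op y) :
    (LinearMap.range (integratedWith μ π)).topologicalClosure ≤
      (LinearMap.range (integratedWith ν ρ)).topologicalClosure := by
  set A := (LinearMap.range (integratedWith ν ρ)).topologicalClosure
  have hA : IsClosed (A : Set (E →L[ℂ] E)) := Submodule.isClosed_topologicalClosure _
  refine topologicalClosure_range_integratedWith_le π A hA fun f hf hfc => ?_
  refine hA.closure_subset (Metric.mem_closure_iff.2 fun ε hε => ?_)
  -- With `T = π(f)`, the map `x ↦ π(x)T` is norm continuous; `hl` transfers this to `ρ`, whose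
  -- approximate unit then gives `ρ(g)T` close to `T`.
  obtain ⟨g, hg, hgc, hgT⟩ := exists_norm_integratedWith_comp_sub_le (μ := ν) ρ _
    (hl _ (continuous_op_comp_integratedWith (μ := μ) π hf hfc)) (half_pos hε)
  -- The approximant `ρ(g)π(f)` lies in `A`: each `ρ(g)π(x)` is some `ρ(g)ρ(y)`, a multiple of `ρ`
  -- of a right translate of `g`.
  refine ⟨_, comp_integratedWith_mem π _
    (hr _ (continuous_integratedWith_comp_op (μ := ν) ρ hg hgc)) A hA (fun x => ?_)
    (hf.integrable_of_hasCompactSupport (μ := μ) hfc), ?_⟩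
  · obtain ⟨y, hy⟩ := hm x
    rw [hy, integratedWith_comp_op ρ hg hgc]
    exact A.smul_mem _ (Submodule.le_topologicalClosure _
      (LinearMap.mem_range_self (integratedWith ν ρ) _))
  · rw [dist_comm, dist_eq_norm]
    linarith

end Integrated

open MeasureTheory Topology Filter

/-! ### Cyclic subrepresentations and universal representations -/

section Cyclic

variable {G : Type u} [Group G] [TopologicalSpace G]
variable {E : Type v} [NormedAddCommGroup E] [NormedSpace ℂ E]

/-- The closed linear span of the orbit of `ξ`. -/
def IsoRep.cyclicSubspace (π : IsoRep G E) (ξ : E) : Submodule ℂ E :=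
  (Submodule.span ℂ (Set.range fun x => π x ξ)).topologicalClosure

theorem IsoRep.isClosed_cyclicSubspace (π : IsoRep G E) (ξ : E) :
    IsClosed (π.cyclicSubspace ξ : Set E) :=
  Submodule.isClosed_topologicalClosure _

theorem IsoRep.apply_self_mem_cyclicSubspace (π : IsoRep G E) (ξ : E) (x : G) :
    π x ξ ∈ π.cyclicSubspace ξ :=
  Submodule.le_topologicalClosure _ (Submodule.subset_span ⟨x, rfl⟩)

theorem IsoRep.cyclicSubspace_le (π : IsoRep G E) {ξ : E} {A : Submodule ℂ E}
    (hA : IsClosed (A : Set E)) (h : ∀ x, π x ξ ∈ A) : π.cyclicSubspace ξ ≤ A :=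
  Submodule.topologicalClosure_minimal _ (Submodule.span_le.2 (by rintro _ ⟨x, rfl⟩; exact h x)) hA

theorem IsoRep.apply_mem_cyclicSubspace (π : IsoRep G E) (ξ : E) (x : G) (ζ : E)
    (hζ : ζ ∈ π.cyclicSubspace ξ) : π x ζ ∈ π.cyclicSubspace ξ := by
  have hc : IsClosed ((π.cyclicSubspace ξ).comap ((π x).toLinearEquiv : E →ₗ[ℂ] E) : Set E) :=
    (π.isClosed_cyclicSubspace ξ).preimage (π x).continuous
  refine π.cyclicSubspace_le hc (fun y => ?_) hζ
  change π x (π y ξ) ∈ π.cyclicSubspace ξ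
  rw [← π.map_mul_apply]
  exact π.apply_self_mem_cyclicSubspace ξ _

theorem IsoRep.self_mem_cyclicSubspace (π : IsoRep G E) (ξ : E) : ξ ∈ π.cyclicSubspace ξ := by
  simpa only [π.map_one_apply] using π.apply_self_mem_cyclicSubspace ξ 1

/-- The restriction of a representation to the closed linear span of an orbit. -/
abbrev IsoRep.cyclicRep (π : IsoRep G E) (ξ : E) : IsoRep G (π.cyclicSubspace ξ) :=
  π.restrict _ (π.apply_mem_cyclicSubspace ξ)

theorem IsoRep.mem_costs_of_coefficient (π : IsoRep G E) {u : G → ℂ} (ξ : E) (η : StrongDual ℂ E)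
    (h : ∀ x, η (π x ξ) = u x) : ‖ξ‖ * ‖η‖ ∈ π.costs u := by
  classical
  refine ⟨Pi.single 0 ξ, Pi.single 0 η, ⟨?_, fun x => ?_⟩, ?_⟩
  · refine summable_of_ne_finset_zero (s := {0}) fun n hn => ?_
    have : n ≠ 0 := by simpa using hn
    simp [this]
  · rw [← h x]
    have := hasSum_single (f := fun n => (Pi.single 0 η : ℕ → StrongDual ℂ E) n
      (π x ((Pi.single 0 ξ : ℕ → E) n))) 0 (fun n hn => by simp [hn])
    simpa using this
  · rw [tsum_eq_single 0 fun n hn => by simp [hn]]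
    simp

variable [IsTopologicalGroup G] [LocallyCompactSpace G]

/-- Orbits lie in the closure of the vectors `π(f) ξ`. -/
theorem apply_mem_closure_range_integratedWith [MeasurableSpace G] [BorelSpace G] (μ : Measure G)
    [μ.IsHaarMeasure] [μ.Regular] [CompleteSpace E] (π : IsoRep G E) (ξ : E) (x : G) :
    π x ξ ∈ closure (Set.range fun f : Lp ℂ 1 μ => integratedWith μ π f ξ) := by
  refine Metric.mem_closure_iff.2 fun ε hε => ?_
  have hU : {y | ‖π y ξ - π x ξ‖ ≤ ε / 2} ∈ 𝓝 x := by
    have hc : ContinuousAt (fun y => ‖π y ξ - π x ξ‖) x :=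
      ((π.continuous_apply ξ).sub continuous_const).norm.continuousAt
    refine hc.tendsto.eventually_le_const ?_
    rw [sub_self, norm_zero]
    exact half_pos hε
  obtain ⟨f, hf, hfc, hf0, hfU, hf1⟩ := exists_bump μ hU
  have hi := hf.integrable_of_hasCompactSupport (μ := μ) hfc
  refine ⟨_, ⟨hi.ofReal.toL1 _, rfl⟩, ?_⟩
  simp only
  rw [integratedWith_toL1, dist_comm, dist_eq_norm]
  exact (norm_integral_bump_sub_le hi hf0 hf1 (integrable_smul_rep μ π hi.ofReal _) hfU).trans_lt
    (half_lt_self hε)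

instance isHaarMeasure_leftHaar :
    @Measure.IsHaarMeasure G _ _ (borel G) (leftHaar G) :=
  letI : MeasurableSpace G := borel G
  haveI : BorelSpace G := ⟨rfl⟩
  inferInstanceAs (Measure.IsHaarMeasure (Measure.haar (G := G)))

theorem apply_mem_closure_range_integrated [CompleteSpace E] (π : IsoRep G E) (ξ : E) (x : G) :
    π x ξ ∈ closure (Set.range fun f : L1 G => π.integrated f ξ) :=
  letI : MeasurableSpace G := borel G
  haveI : BorelSpace G := ⟨rfl⟩
  apply_mem_closure_range_integratedWith (leftHaar G) π ξ x

/-- Cyclicity is defined through `L_1(G)`, the subspace through the orbit; the two agree because the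
orbit lies in the closure of the vectors `π(f)ξ`. -/
theorem inCyc_cyclicRep {E : Type u} [NormedAddCommGroup E] [NormedSpace ℂ E] [CompleteSpace E]
    {p : ℝ≥0∞} [Fact (1 ≤ p)] (π : IsoRep G E) (hπ : InRep p π) (ξ : E) :
    InCyc p (π.cyclicRep ξ) := by
  have hc := π.isClosed_cyclicSubspace ξ
  have : CompleteSpace (π.cyclicSubspace ξ) := hc.completeSpace_coe
  let ξ₀ : π.cyclicSubspace ξ := ⟨ξ, π.self_mem_cyclicSubspace ξ⟩
  refine ⟨IsQSL.submodule hπ _ hc, ξ₀, ?_⟩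
  let L : L1 G →ₗ[ℂ] π.cyclicSubspace ξ :=
    (LinearMap.applyₗ ξ₀ ∘ₗ ContinuousLinearMap.coeLM ℂ) ∘ₗ (π.cyclicRep ξ).integrated
  let A := (LinearMap.range L).topologicalClosure
  have hA : ∀ x, π.cyclicRep ξ x ξ₀ ∈ A :=
    apply_mem_closure_range_integrated (π.cyclicRep ξ) ξ₀
  have hAc : IsClosed (A.map (π.cyclicSubspace ξ).subtype : Set E) :=
    hc.isClosedEmbedding_subtypeVal.isClosedMap _ (Submodule.isClosed_topologicalClosure _)
  have hle : π.cyclicSubspace ξ ≤ A.map (π.cyclicSubspace ξ).subtype :=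
    π.cyclicSubspace_le hAc fun x => ⟨_, hA x, rfl⟩
  intro ζ
  obtain ⟨ζ', h1, h2⟩ := hle ζ.2
  have : ζ' = ζ := Subtype.ext h2
  exact this ▸ h1

/-- Coefficient functions of a representation in `Rep_p(G)` are coefficient functions of a
`p`-universal representation, with no larger norms. -/
theorem IsUniversal.exists_coefficient {E F : Type u} [NormedAddCommGroup E] [NormedSpace ℂ E]
    [NormedAddCommGroup F] [NormedSpace ℂ F] [CompleteSpace F] {p : ℝ≥0∞} [Fact (1 ≤ p)]
    {π : IsoRep G E} (hπ : IsUniversal p π) {τ : IsoRep G F} (hτ : InRep p τ) (ξ : F)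
    (η : StrongDual ℂ F) :
    ∃ (ξ' : E) (η' : StrongDual ℂ E), (∀ x, η' (π x ξ') = η (τ x ξ)) ∧ ‖ξ'‖ * ‖η'‖ ≤ ‖ξ‖ * ‖η‖ := by
  have : CompleteSpace (τ.cyclicSubspace ξ) := (τ.isClosed_cyclicSubspace ξ).completeSpace_coe
  obtain ⟨S, hSc, hS, T, hT⟩ := hπ.2 _ (τ.cyclicRep ξ) (inCyc_cyclicRep τ hτ ξ)
  let ξ₀ : τ.cyclicSubspace ξ := ⟨ξ, τ.self_mem_cyclicSubspace ξ⟩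
  let η₀ : StrongDual ℂ S := (η.comp (τ.cyclicSubspace ξ).subtypeL).comp
    (T.symm.toContinuousLinearEquiv : S →L[ℂ] τ.cyclicSubspace ξ)
  have hη₀ : ‖η₀‖ ≤ ‖η‖ := ContinuousLinearMap.opNorm_le_bound _ (norm_nonneg _) fun s => by
    refine (η.le_opNorm _).trans_eq ?_
    congr 1
    exact T.symm.norm_map s
  -- Hahn–Banach: extending from the copy `S` to `E` keeps the norm, and the coefficient sees only
  -- the orbit inside `S`.
  obtain ⟨η', h1, h2⟩ := exists_extension_norm_eq S η₀
  refine ⟨T ξ₀, η', fun x => ?_, ?_⟩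
  · have e : π x (T ξ₀ : E) = (T (τ.cyclicRep ξ x ξ₀) : S) := congrArg Subtype.val (hT x ξ₀).symm
    rw [e, h1]
    change η (T.symm (T (τ.cyclicRep ξ x ξ₀)) : τ.cyclicSubspace ξ) = _
    rw [T.symm_apply_apply]
    rfl
  · have : ‖(T ξ₀ : E)‖ = ‖ξ‖ := T.norm_map ξ₀
    rw [this, h2]
    gcongr

/-- Each term has its own cyclic subrepresentation, so the terms of an expansion can be moved into
`π` one at a time. -/
theorem IsUniversal.exists_cost_le {E F : Type u} [NormedAddCommGroup E] [NormedSpace ℂ E]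
    [NormedAddCommGroup F] [NormedSpace ℂ F] [CompleteSpace F] {p : ℝ≥0∞} [Fact (1 ≤ p)]
    {π : IsoRep G E} (hπ : IsUniversal p π) {τ : IsoRep G F} (hτ : InRep p τ) {u : G → ℂ} {r : ℝ}
    (hr : r ∈ τ.costs u) : ∃ s ∈ π.costs u, s ≤ r := by
  obtain ⟨ξ, η, ⟨h1, h2⟩, rfl⟩ := hr
  choose ξ' η' h3 h4 using fun n => hπ.exists_coefficient hτ (ξ n) (η n)
  have hs : Summable fun n => ‖ξ' n‖ * ‖η' n‖ :=
    h1.of_nonneg_of_le (fun n => by positivity) h4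
  exact ⟨_, ⟨ξ', η', ⟨hs, fun x => by simpa only [h3] using h2 x⟩, rfl⟩, hs.tsum_le_tsum h4 h1⟩

end Cyclic

/-! ### Representations of a quotient group -/

section Quotient

variable {G : Type u} [Group G] [TopologicalSpace G] [IsTopologicalGroup G] [LocallyCompactSpace G]
variable (N : Subgroup G) [N.Normal]

/-- The quotient topology makes norm continuity on `G` and on `G ⧸ N` equivalent for these
operators, so the one-sided inclusion applies in both directions. -/
theorem pseudofunctions_compQuotient {F : Type v} [NormedAddCommGroup F] [NormedSpace ℂ F]
    [CompleteSpace F] (ρ : IsoRep (G ⧸ N) F) :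
    ρ.pseudofunctions = (ρ.compQuotient N).pseudofunctions := by
  let : MeasurableSpace G := borel G
  have : BorelSpace G := ⟨rfl⟩
  let : MeasurableSpace (G ⧸ N) := borel (G ⧸ N)
  have : BorelSpace (G ⧸ N) := ⟨rfl⟩
  have hq : IsQuotientMap (fun x : G => (x : G ⧸ N)) := QuotientGroup.isQuotientMap_mk N
  refine le_antisymm
    (topologicalClosure_range_integratedWith_mono (μ := leftHaar (G ⧸ N)) (ν := leftHaar G)
      ρ (ρ.compQuotient N) (fun T hT => hT.comp hq.continuous)
      (fun S hS => hq.continuous_iff.2 hS) fun y => ?_)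
    (topologicalClosure_range_integratedWith_mono (μ := leftHaar G) (ν := leftHaar (G ⧸ N))
      (ρ.compQuotient N) ρ (fun T hT => hq.continuous_iff.2 hT)
      (fun S hS => hS.comp hq.continuous) fun x => ⟨(x : G ⧸ N), rfl⟩)
  obtain ⟨x, rfl⟩ := QuotientGroup.mk_surjective y
  exact ⟨x, rfl⟩

/-- Evaluation at `ξ` is continuous on `B(F)`, so equality of pseudofunctions keeps the same cyclic
vector. -/
theorem InCyc.compQuotient {F : Type u} [NormedAddCommGroup F] [NormedSpace ℂ F]
    [CompleteSpace F] {p : ℝ≥0∞} [Fact (1 ≤ p)] {ρ : IsoRep (G ⧸ N) F} (h : InCyc p ρ) :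
    InCyc p (ρ.compQuotient N) := by
  obtain ⟨hρ, ξ, hξ⟩ := h
  refine ⟨hρ, ξ, dense_closure.1 (hξ.mono ?_)⟩
  rintro _ ⟨f, rfl⟩
  have hf : ρ.integrated f ∈ (ρ.compQuotient N).pseudofunctions := by
    rw [← pseudofunctions_compQuotient]
    exact Submodule.le_topologicalClosure _ (LinearMap.mem_range_self _ _)
  have := map_mem_closure (f := fun T : F →L[ℂ] F => T ξ) (by fun_prop) hf
    (t := Set.range fun f : L1 G => (ρ.compQuotient N).integrated f ξ)
    (by rintro _ ⟨g, rfl⟩; exact ⟨g, rfl⟩)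
  exact this

theorem fixedRep_containedIn {E : Type v} [NormedAddCommGroup E] [NormedSpace ℂ E]
    (π : IsoRep G E) : ((π.fixedRep N).compQuotient N).ContainedIn π :=
  ⟨π.fixedVectors N, π.isClosed_fixedVectors N, π.apply_mem_fixedVectors N,
    LinearIsometryEquiv.refl ℂ _, fun _ _ => rfl⟩

theorem IsoRep.ContainedIn.fixedRep {E : Type v} [NormedAddCommGroup E] [NormedSpace ℂ E]
    {F : Type w} [NormedAddCommGroup F] [NormedSpace ℂ F] {π : IsoRep G E} {ρ : IsoRep (G ⧸ N) F}
    (h : (ρ.compQuotient N).ContainedIn π) : ρ.ContainedIn (π.fixedRep N) := by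
  obtain ⟨S, hSc, hS, T, hT⟩ := h
  -- `N` acts trivially under the lift of `ρ`, hence on its copy `S` in `E`.
  have hSK : S ≤ π.fixedVectors N := fun s hs n hn => by
    have h1 := hT n (T.symm ⟨s, hs⟩)
    rw [T.apply_symm_apply] at h1
    have h2 : ρ.compQuotient N n (T.symm ⟨s, hs⟩) = T.symm ⟨s, hs⟩ := by
      change ρ (n : G ⧸ N) _ = _
      rw [(QuotientGroup.eq_one_iff n).2 hn, ρ.map_one_apply]
    rw [h2, T.apply_symm_apply] at h1
    exact (congrArg Subtype.val h1).symm
  let S' : Submodule ℂ (π.fixedVectors N) := S.comap (π.fixedVectors N).subtype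
  have hinv : ∀ (y : G ⧸ N), ∀ ξ ∈ S', π.fixedRep N y ξ ∈ S' := fun y ξ hξ => by
    obtain ⟨x, rfl⟩ := QuotientGroup.mk_surjective y
    exact hS x ξ hξ
  let e : S ≃ₗᵢ[ℂ] S' :=
    { toLinearEquiv := (Submodule.comapSubtypeEquivOfLe hSK).symm
      norm_map' := fun _ => rfl }
  refine ⟨S', hSc.preimage continuous_subtype_val, hinv, T.trans e, fun y ξ => ?_⟩
  obtain ⟨x, rfl⟩ := QuotientGroup.mk_surjective y
  have h : ((T (ρ.compQuotient N x ξ) : S) : E) = π x (T ξ) := congrArg Subtype.val (hT x ξ)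
  exact Subtype.ext (Subtype.ext h)

theorem IsUniversal.fixedRep {E : Type u} [NormedAddCommGroup E] [NormedSpace ℂ E]
    {p : ℝ≥0∞} [Fact (1 ≤ p)] {π : IsoRep G E} (hπ : IsUniversal p π) :
    IsUniversal p (π.fixedRep N) :=
  ⟨IsQSL.submodule hπ.1 _ (π.isClosed_fixedVectors N), fun F _ _ _ ρ hρ =>
    IsoRep.ContainedIn.fixedRep N (hπ.2 F (ρ.compQuotient N) (InCyc.compQuotient N hρ))⟩

/-! ### Comparison of coefficient norms on `G` and on `G ⧸ N`. -/

variable {E F : Type u} [NormedAddCommGroup E] [NormedSpace ℂ E]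
  [NormedAddCommGroup F] [NormedSpace ℂ F] {p : ℝ≥0∞} [Fact (1 ≤ p)]
  {π : IsoRep G E} {σ : IsoRep (G ⧸ N) F}

theorem IsUniversal.exists_cost_comp_mk_le [CompleteSpace F] (hπ : IsUniversal p π) (hσ : InRep p σ)
    {u : G ⧸ N → ℂ} {r : ℝ} (hr : r ∈ σ.costs u) :
    ∃ s ∈ π.costs (fun x => u (x : G ⧸ N)), s ≤ r := by
  obtain ⟨ξ, η, ⟨h1, h2⟩, rfl⟩ := hr
  exact hπ.exists_cost_le (τ := σ.compQuotient N) hσ ⟨ξ, η, ⟨h1, fun x => h2 x⟩, rfl⟩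

/-- The hard inequality. Only the sum of the expansion is known to be constant on cosets, so it is
collapsed to a single coefficient before the passage to `G ⧸ N`. -/
theorem IsUniversal.exists_cost_le_of_comp_mk [CompleteSpace E] (hp : 1 < p) (hp' : p < ⊤)
    (hπ : InRep p π) (hσ : IsUniversal p σ) {u : G ⧸ N → ℂ} {r : ℝ} (hr : r ∈ π.costs (fun x => u (x : G ⧸ N))) :
    ∃ s ∈ σ.costs u, s ≤ r := by
  obtain ⟨f, η, h1, h2⟩ := π.exists_lpRep_coefficient p hp hp' hr
  obtain ⟨F', _, _, _, ρ, ξ', η', hρ, h3, h4⟩ :=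
    (π.lpRep p hp').exists_quotient_coefficient N p (IsQSL.lp hp' hπ) f η u h1
  obtain ⟨s, hs, hs'⟩ := hσ.exists_cost_le hρ (ρ.mem_costs_of_coefficient ξ' η' h3)
  exact ⟨s, hs, hs'.trans (h4.trans h2)⟩

variable [CompleteSpace E] [CompleteSpace F]

/-- The map `u ↦ u ∘ q` between the spaces of coefficient functions of `p`-universal
representations. -/
def compMk (hp : 1 < p) (hp' : p < ⊤) (hπ : IsUniversal p π) (hσ : IsUniversal p σ) :
    FourierSpace σ →ₗᵢ[ℂ] FourierSpace π where
  toFun u := ⟨fun x => u (x : G ⧸ N), by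
    obtain ⟨r, hr⟩ := FourierSpace.costs_nonempty u
    obtain ⟨s, ⟨ξ, η, h, -⟩, -⟩ := hπ.exists_cost_comp_mk_le N hσ.1 hr
    exact ⟨ξ, η, h⟩⟩
  map_add' _ _ := rfl
  map_smul' _ _ := rfl
  norm_map' u := by
    refine le_antisymm (le_csInf (FourierSpace.costs_nonempty u) fun r hr => ?_)
      (le_csInf (FourierSpace.costs_nonempty _) fun r hr => ?_)
    · obtain ⟨s, hs, hsr⟩ := hπ.exists_cost_comp_mk_le N hσ.1 hr
      exact (FourierSpace.norm_le_cost _ hs).trans hsr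
    · obtain ⟨s, hs, hsr⟩ := hσ.exists_cost_le_of_comp_mk N hp hp' hπ.1 hr
      exact (FourierSpace.norm_le_cost _ hs).trans hsr

theorem compMk_apply (hp : 1 < p) (hp' : p < ⊤) (hπ : IsUniversal p π) (hσ : IsUniversal p σ)
    (u : FourierSpace σ) (x : G) : compMk N hp hp' hπ hσ u x = u (x : G ⧸ N) := rfl

theorem compMk_mem_constOnCosets (hp : 1 < p) (hp' : p < ⊤) (hπ : IsUniversal p π)
    (hσ : IsUniversal p σ) (u : FourierSpace σ) :
    compMk N hp hp' hπ hσ u ∈ FourierSpace.constOnCosets π N := fun x y h => by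
  rw [compMk_apply, compMk_apply, h]

/-- The isometric identification of `B_p(G ⧸ N)` with `B_p(G : N)`. -/
def constOnCosetsEquiv (hp : 1 < p) (hp' : p < ⊤) (hπ : IsUniversal p π) (hσ : IsUniversal p σ) :
    FourierSpace σ ≃ₗᵢ[ℂ] FourierSpace.constOnCosets π N where
  toLinearEquiv := LinearEquiv.ofBijective
    ((compMk N hp hp' hπ hσ).toLinearMap.codRestrict _
      (compMk_mem_constOnCosets N hp hp' hπ hσ)) <| by
      refine ⟨fun u v h => (compMk N hp hp' hπ hσ).injective (congrArg Subtype.val h), ?_⟩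
      rintro ⟨v, hv⟩
      let u : G ⧸ N → ℂ := Quotient.lift (fun x => v x) fun x y h => hv x y (Quotient.sound h)
      obtain ⟨r, hr⟩ := FourierSpace.costs_nonempty v
      -- The hard inequality also yields surjectivity: it produces an expansion over `σ` of the
      -- descended function `u`.
      obtain ⟨s, ⟨ξ, η, h, -⟩, -⟩ := hσ.exists_cost_le_of_comp_mk N hp hp' hπ.1 (u := u) hr
      exact ⟨⟨u, ξ, η, h⟩, rfl⟩
  norm_map' u := (compMk N hp hp' hπ hσ).norm_map u

end Quotient

end PFourier

end

theorem mainTheorem4 {G : Type u} [Group G] [TopologicalSpace G] [IsTopologicalGroup G]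
    [LocallyCompactSpace G] [T2Space G]
    (p : ℝ≥0∞) [Fact (1 ≤ p)] (hp : 1 < p) (hp' : p < ⊤)
    (N : Subgroup G) [N.Normal] (hN : IsClosed (N : Set G)) :
    -- representations of the quotient lift, with the same pseudofunctions in `B(F)`
    (∀ (F : Type u) [NormedAddCommGroup F] [NormedSpace ℂ F] [CompleteSpace F]
        (ρ : PFourier.IsoRep (G ⧸ N) F), PFourier.InRep p ρ →
        PFourier.InRep p (ρ.compQuotient N) ∧
        ρ.pseudofunctions = (ρ.compQuotient N).pseudofunctions) ∧
    -- the representation of the quotient on the `N`-fixed vectors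
    (∀ (E : Type u) [NormedAddCommGroup E] [NormedSpace ℂ E] [CompleteSpace E]
        (π : PFourier.IsoRep G E), PFourier.InRep p π →
        PFourier.InRep p (π.fixedRep N) ∧
        ((π.fixedRep N).compQuotient N).ContainedIn π ∧
        (PFourier.IsUniversal p π → PFourier.IsUniversal p (π.fixedRep N))) ∧
    -- `B_p(G : N) = B_p(G ⧸ N)` isometrically, and `u ↦ u ∘ q` is isometric
    (∀ (E : Type u) [NormedAddCommGroup E] [NormedSpace ℂ E] [CompleteSpace E]
        (π : PFourier.IsoRep G E), PFourier.IsUniversal p π →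
      ∀ (F : Type u) [NormedAddCommGroup F] [NormedSpace ℂ F] [CompleteSpace F]
        (σ : PFourier.IsoRep (G ⧸ N) F), PFourier.IsUniversal p σ →
        (∃ Ψ : PFourier.FourierSpace σ ≃ₗᵢ[ℂ] PFourier.FourierSpace.constOnCosets π N,
          ∀ (u : PFourier.FourierSpace σ) (x : G),
            (Ψ u : PFourier.FourierSpace π) x = u (x : G ⧸ N)) ∧
        (∃ Φ : PFourier.FourierSpace σ →ₗᵢ[ℂ] PFourier.FourierSpace π,
          ∀ (u : PFourier.FourierSpace σ) (x : G), Φ u x = u (x : G ⧸ N))) := by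
  refine ⟨fun F _ _ _ ρ hρ => ⟨hρ, PFourier.pseudofunctions_compQuotient N ρ⟩,
    fun E _ _ _ π hπ => ⟨PFourier.IsQSL.submodule hπ _ (π.isClosed_fixedVectors N),
      PFourier.fixedRep_containedIn N π, fun h => h.fixedRep N⟩,
    fun E _ _ _ π hπ F _ _ _ σ hσ => ⟨⟨PFourier.constOnCosetsEquiv N hp hp' hπ hσ,
      fun _ _ => rfl⟩, ⟨PFourier.compMk N hp hp' hπ hσ, fun _ _ => rfl⟩⟩⟩
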